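/- Let $k$ be a field and $q\in k^\times$ with $[2]_q=q+q^{-1}\neq 0$. For $n\ge 0$ let $T_n=T_n(q)$ be the Temperley–Lieb algebra over $k$, generated by $U_1,\dots,U_{n-1}$ with relations $U_i^2=[2]_qU_i$, $U_iU_{i\pm1}U_i=U_i$, $U_iU_j=U_jU_i$ for $|i-j|\neq1$. It acts on $V^{\otimes n}$, where $V$ has basis $v_1,v_2$: $U_i$ acts on the $i$-th and $(i+1)$-th tensor factors by $v_1\otimes v_2\mapsto q\,v_1\otimes v_2+v_2\otimes v_1$, $v_2\otimes v_1\mapsto v_1\otimes v_2+q^{-1}v_2\otimes v_1$, $v_1\otimes v_1\mapsto 0$, $v_2\otimes v_2\mapsto0$, and as the identity on the other factors. For $0\le r\le n$ the permutation submodule $M(2r-n,n)\subseteq V^{\otimes n}$ is the span of the words $v_{i_1}\otimes\cdots\otimes v_{i_n}$ in which exactly $r$ of the letters are $v_1$. The algebra $T_n$ is quasihereditary with weights $\lambda\in\Lambda_n=\{n,n-2,\dots,0\text{ or }1\}$, ordered by the reverse of the natural order, and with the heredity chain given by the idempotents $e_\lambda=[2]_q^{-l}U_{n-1}U_{n-3}\cdots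 U_{n-2l+1}$ for $\lambda=n-2l$. With $J_\lambda=\sum_{\mu<\lambda}T_ne_\mu T_n$ (natural order on $\mu,\lambda\in\Lambda_n$) its standard modules are $\Delta_n(\lambda)=T_ne_\lambda/J_\lambda e_\lambda$, and its costandard modules are the $k$-linear duals $\nabla_n(\lambda)=(e_\lambda T_n/e_\lambda J_\lambda)^*$ of the standard right modules. A tilting module is a finitely generated $T_n$-module that has a finite filtration with all subquotients standard modules and also one with all subquotients costandard modules. For $n\ge2$ put $\epsilon=[2]_q^{-1}U_{n-1}$, let $F(M)=\epsilon M$ be the localization functor from $T_n$-modules to $T_{n-2}$-modules, and let $G(N)=T_n\epsilon\otimes_{T_{n-2}}N$ be its left adjoint. **Theorem.** (1) For every $n\ge0$, $V^{\otimes n}$ is a tilting module for $T_n$. (2) For every $n\ge 0$ and $0\le r\le n$, $M(2r-n,n)$ is a tilting module for $T_n$. (3) For every $n\ge2$ the adjunction map $G\circ F(V^{\otimes n})\to V^{\otimes n}$, $x\otimes v\mapsto xv$, is injective. -/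

import Mathlib

open scoped TensorProduct

noncomputable section

/-! ### Standard, costandard and tilting modules of an algebra with a heredity chain -/

section Quasihereditary

universe u v w

/-- `M` has a finite filtration by submodules `0 = N 0 ≤ N 1 ≤ ⋯ ≤ N m = M` each of whose
subquotients is isomorphic to some member of the family `S` of modules. -/
def HasFiltration (A : Type u) [Ring A] {ι : Type*} (S : ι → Type v)
    [∀ i, AddCommGroup (S i)] [∀ i, Module A (S i)]
    (M : Type w) [AddCommGroup M] [Module A M] : Prop :=
  ∃ (m : ℕ) (N : Fin (m + 1) → Submodule A M),
    N 0 = ⊥ ∧ N (Fin.last m) = ⊤ ∧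
    ∀ j : Fin m, N j.castSucc ≤ N j.succ ∧
      ∃ i, Nonempty ((↥(N j.succ) ⧸ (N j.castSucc).submoduleOf (N j.succ)) ≃ₗ[A] S i)

/-- The two-sided ideal `∑_{j > i} A e_j A`, as a left ideal. -/
def higherIdeal {A : Type u} [Ring A] {ι : Type*} [LT ι] (e : ι → A) (i : ι) : Ideal A :=
  Ideal.span {x | ∃ j, i < j ∧ ∃ a : A, x = e j * a}

/-- The standard module `Δ(i) = A e_i / (J_{>i} ∩ A e_i) = A e_i / J_{>i} e_i`, where
`J_{>i} = ∑_{j > i} A e_j A`, of an algebra `A` with idempotents `e_i` that define a heredity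
chain (with `e_i` primitive modulo `J_{>i}`). -/
abbrev Standard {A : Type u} [Ring A] {ι : Type*} [LT ι] (e : ι → A) (i : ι) : Type u :=
  ↥(Ideal.span {e i}) ⧸ Submodule.submoduleOf (higherIdeal e i) (Ideal.span {e i})

/-- The costandard module `∇(i)`: the `k`-linear dual of the standard right module with index
`i`, that is, of the standard module of the opposite algebra. -/
def Costandard (k : Type u) [Field k] {A : Type u} [Ring A] [Algebra k A] {ι : Type*} [LT ι]
    (e : ι → A) (i : ι) : Type u :=
  Standard (fun j => MulOpposite.op (e j)) i →ₗ[k] k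

variable (k : Type u) [Field k] {A : Type u} [Ring A] [Algebra k A] {ι : Type*} [LT ι]
  (e : ι → A) (i : ι)

instance : AddCommGroup (Costandard k e i) :=
  inferInstanceAs (AddCommGroup (Standard (fun j => MulOpposite.op (e j)) i →ₗ[k] k))

instance : FunLike (Costandard k e i) (Standard (fun j => MulOpposite.op (e j)) i) k :=
  inferInstanceAs (FunLike (Standard (fun j => MulOpposite.op (e j)) i →ₗ[k] k) _ _)

/-- The left action of `A` on `∇(i)`: `(a • f) x = f (x a)`. -/
instance : SMul A (Costandard k e i) where
  smul a f := LinearMap.comp (show Standard (fun j => MulOpposite.op (e j)) i →ₗ[k] k from f)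
    (Algebra.lsmul k k (Standard (fun j => MulOpposite.op (e j)) i) (MulOpposite.op a))

namespace Costandard

theorem smul_apply (a : A) (f : Costandard k e i)
    (x : Standard (fun j => MulOpposite.op (e j)) i) :
    (a • f) x = f (MulOpposite.op a • x) := rfl

theorem map_add (f : Costandard k e i) (x y : Standard (fun j => MulOpposite.op (e j)) i) :
    f (x + y) = f x + f y :=
  LinearMap.map_add (show Standard (fun j => MulOpposite.op (e j)) i →ₗ[k] k from f) x y

theorem map_zero (f : Costandard k e i) : f 0 = 0 :=
  LinearMap.map_zero (show Standard (fun j => MulOpposite.op (e j)) i →ₗ[k] k from f)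

theorem ext {f g : Costandard k e i} (h : ∀ x, f x = g x) : f = g := LinearMap.ext h

end Costandard

instance : Module A (Costandard k e i) where
  one_smul f := Costandard.ext k e i fun x => by
    rw [Costandard.smul_apply, MulOpposite.op_one, one_smul]
  mul_smul a b f := Costandard.ext k e i fun x => by
    rw [Costandard.smul_apply, Costandard.smul_apply, Costandard.smul_apply, MulOpposite.op_mul,
      mul_smul]
  smul_zero a := rfl
  smul_add a f g := rfl
  add_smul a b f := Costandard.ext k e i fun x => by
    rw [Costandard.smul_apply, MulOpposite.op_add, add_smul, Costandard.map_add]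
    rfl
  zero_smul f := Costandard.ext k e i fun x => by
    rw [Costandard.smul_apply, MulOpposite.op_zero, zero_smul, Costandard.map_zero]
    rfl

/-- A tilting module: a finitely generated module which has both a filtration by standard
modules and a filtration by costandard modules. -/
def IsTilting (M : Type w) [AddCommGroup M] [Module A M] : Prop :=
  Module.Finite A M ∧ HasFiltration A (fun i => Standard e i) M ∧
    HasFiltration A (fun i => Costandard k e i) M

end Quasihereditary

/-! ### The Temperley–Lieb algebra -/

section TemperleyLieb

universe u w

variable {k : Type u} [Field k]

/-- The quantum number `[2]_q`. -/
def qTwo (q : k) : k := q + q⁻¹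

/-- The Temperley–Lieb relations. The generators `U_1, …, U_{n-1}` are indexed from `0`. -/
inductive TLRel (q : k) (n : ℕ) :
    FreeAlgebra k (Fin (n - 1)) → FreeAlgebra k (Fin (n - 1)) → Prop
  | sq (i : Fin (n - 1)) :
      TLRel q n (FreeAlgebra.ι k i * FreeAlgebra.ι k i) (qTwo q • FreeAlgebra.ι k i)
  | adj (i j : Fin (n - 1)) (h : i.val + 1 = j.val ∨ j.val + 1 = i.val) :
      TLRel q n (FreeAlgebra.ι k i * FreeAlgebra.ι k j * FreeAlgebra.ι k i) (FreeAlgebra.ι k i)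
  | comm (i j : Fin (n - 1)) (h : ¬ (i.val + 1 = j.val ∨ j.val + 1 = i.val)) :
      TLRel q n (FreeAlgebra.ι k i * FreeAlgebra.ι k j) (FreeAlgebra.ι k j * FreeAlgebra.ι k i)

/-- The Temperley–Lieb algebra `T_n(q)`. -/
def TL (q : k) (n : ℕ) : Type u := RingQuot (TLRel q n)

namespace TL

instance (q : k) (n : ℕ) : Ring (TL q n) := inferInstanceAs (Ring (RingQuot (TLRel q n)))

instance (q : k) (n : ℕ) : Algebra k (TL q n) :=
  inferInstanceAs (Algebra k (RingQuot (TLRel q n)))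

/-- The generator `U_{i+1}`. -/
def U (q : k) {n : ℕ} (i : Fin (n - 1)) : TL q n :=
  RingQuot.mkAlgHom k (TLRel q n) (FreeAlgebra.ι k i)

theorem U_sq (q : k) {n : ℕ} (i : Fin (n - 1)) : U q i * U q i = qTwo q • U q i := by
  have := RingQuot.mkAlgHom_rel k (TLRel.sq (q := q) i)
  rw [map_mul, map_smul] at this
  exact this

theorem U_adj (q : k) {n : ℕ} (i j : Fin (n - 1))
    (h : i.val + 1 = j.val ∨ j.val + 1 = i.val) : U q i * U q j * U q i = U q i := by
  have := RingQuot.mkAlgHom_rel k (TLRel.adj (q := q) i j h)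
  rw [map_mul, map_mul] at this
  exact this

theorem U_comm (q : k) {n : ℕ} (i j : Fin (n - 1))
    (h : ¬ (i.val + 1 = j.val ∨ j.val + 1 = i.val)) : U q i * U q j = U q j * U q i := by
  have := RingQuot.mkAlgHom_rel k (TLRel.comm (q := q) i j h)
  rw [map_mul, map_mul] at this
  exact this

/-- The universal property of the presentation. -/
def lift (q : k) {n : ℕ} {B : Type w} [Ring B] [Algebra k B] (f : Fin (n - 1) → B)
    (hsq : ∀ i, f i * f i = qTwo q • f i)
    (hadj : ∀ i j, (i.val + 1 = j.val ∨ j.val + 1 = i.val) → f i * f j * f i = f i)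
    (hcomm : ∀ i j, ¬ (i.val + 1 = j.val ∨ j.val + 1 = i.val) → f i * f j = f j * f i) :
    TL q n →ₐ[k] B :=
  RingQuot.liftAlgHom k ⟨FreeAlgebra.lift k f, by
    intro x y h
    cases h with
    | sq i => simpa using hsq i
    | adj i j h => simpa using hadj i j h
    | comm i j h => simpa using hcomm i j h⟩

theorem lift_U (q : k) {n : ℕ} {B : Type w} [Ring B] [Algebra k B] (f : Fin (n - 1) → B)
    (hsq hadj hcomm) (i : Fin (n - 1)) :
    lift q f hsq hadj hcomm (U q i) = f i := by
  unfold lift U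
  erw [RingQuot.liftAlgHom_mkAlgHom_apply]
  simp

theorem induction (q : k) {n : ℕ} {C : TL q n → Prop}
    (halg : ∀ c : k, C (algebraMap k _ c)) (hU : ∀ i, C (U q i))
    (hmul : ∀ a b, C a → C b → C (a * b)) (hadd : ∀ a b, C a → C b → C (a + b))
    (a : TL q n) : C a := by
  obtain ⟨x, rfl⟩ := RingQuot.mkAlgHom_surjective k (TLRel q n) a
  induction x using FreeAlgebra.induction with
  | grade0 c => rw [AlgHom.commutes]; exact halg c
  | grade1 i => exact hU i
  | mul a b ha hb => rw [map_mul]; exact hmul _ _ ha hb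
  | add a b ha hb => rw [map_add]; exact hadd _ _ ha hb

/-- The idempotents `e_l = [2]_q^{-l} U_{n-1} U_{n-3} ⋯ U_{n-2l+1}` for `0 ≤ l ≤ n / 2`, which
define the heredity chain of `T_n(q)` for `[2]_q ≠ 0`. The index `l` stands for the weight
`λ = n - 2l` in `Λ_n = {n, n-2, …, 0 or 1}`; the heredity order, which is the reverse of the natural
order on `Λ_n`, is the natural order on `l`. -/
def idem (q : k) (n : ℕ) (l : Fin (n / 2 + 1)) : TL q n :=
  (List.ofFn fun i : Fin l.val =>
    (qTwo q)⁻¹ • U q (n := n) ⟨n - 2 - 2 * i.val, by omega⟩).prod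

end TL

/-! ### The tensor space and the permutation modules -/

/-- The space `V^{⊗n}`, where `V` has the basis `v_1, v_2` (indexed by `0, 1 : Fin 2`). The parameter
`q` determines the action of `T_n(q)`. -/
def TensorSpace (_q : k) (n : ℕ) : Type u := ⨂[k]^n (Fin 2 → k)

namespace TensorSpace

instance (q : k) (n : ℕ) : AddCommGroup (TensorSpace q n) :=
  inferInstanceAs (AddCommGroup (⨂[k] _ : Fin n, (Fin 2 → k)))

instance (q : k) (n : ℕ) : Module k (TensorSpace q n) :=
  inferInstanceAs (Module k (⨂[k] _ : Fin n, (Fin 2 → k)))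

/-- The basis `v_{i_1} ⊗ ⋯ ⊗ v_{i_n}` of `V^{⊗n}`, indexed by words. -/
def wordBasis (q : k) (n : ℕ) : Module.Basis (Fin n → Fin 2) k (TensorSpace q n) :=
  Basis.piTensorProduct fun _ : Fin n => Pi.basisFun k (Fin 2)

theorem wordBasis_apply (q : k) (n : ℕ) (w : Fin n → Fin 2) :
    wordBasis q n w = PiTensorProduct.tprod k fun i => (Pi.single (w i) 1 : Fin 2 → k) := by
  refine (Basis.piTensorProduct_apply (fun _ : Fin n => Pi.basisFun k (Fin 2)) w).trans ?_
  congr 1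
  ext i : 1
  exact Pi.basisFun_apply k (Fin 2) (w i)

/-- The operator on `V^{⊗n}` that acts on the factors in the positions `a` and `b` by
`v_1 ⊗ v_2 ↦ q v_1 ⊗ v_2 + v_2 ⊗ v_1`, `v_2 ⊗ v_1 ↦ v_1 ⊗ v_2 + q⁻¹ v_2 ⊗ v_1`,
`v_1 ⊗ v_1 ↦ 0`, `v_2 ⊗ v_2 ↦ 0`, and trivially on the other factors. -/
def pairOp (q : k) {n : ℕ} (a b : Fin n) : Module.End k (TensorSpace q n) :=
  (wordBasis q n).constr k fun w =>
    if w a = w b then 0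
    else (if w a = 0 then q else q⁻¹) • wordBasis q n w + wordBasis q n (w ∘ Equiv.swap a b)

theorem pairOp_basis (q : k) {n : ℕ} (a b : Fin n) (w : Fin n → Fin 2) :
    pairOp q a b (wordBasis q n w) = if w a = w b then 0
      else (if w a = 0 then q else q⁻¹) • wordBasis q n w +
        wordBasis q n (w ∘ Equiv.swap a b) := by
  unfold pairOp
  rw [Module.Basis.constr_basis]

theorem pairOp_sq (q : k) (hq : q ≠ 0) {n : ℕ} (a b : Fin n) :
    pairOp q a b * pairOp q a b = qTwo q • pairOp q a b := by
  refine (wordBasis q n).ext fun w => ?_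
  have hc : (w ∘ Equiv.swap a b) ∘ Equiv.swap a b = w := by ext x; simp
  have h2 : ∀ x : Fin 2, x = 0 ∨ x = 1 := by decide
  rcases h2 (w a) with ha | ha <;> rcases h2 (w b) with hb | hb <;>
    simp [pairOp_basis, ha, hb, qTwo, hc, smul_smul, add_smul, hq] <;> module

theorem pairOp_adj (q : k) (hq : q ≠ 0) {n : ℕ} (a b c d : Fin n)
    (h : (b = c ∧ a ≠ b ∧ b ≠ d ∧ a ≠ d) ∨ (a = d ∧ a ≠ b ∧ c ≠ d ∧ b ≠ c)) :
    pairOp q a b * pairOp q c d * pairOp q a b = pairOp q a b := by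
  refine (wordBasis q n).ext fun w => ?_
  have h2 : ∀ x : Fin 2, x = 0 ∨ x = 1 := by decide
  rcases h with ⟨rfl, h1, h3, h4⟩ | ⟨rfl, h1, h3, h4⟩
  · have hc : (w ∘ Equiv.swap a b) ∘ Equiv.swap a b = w := by ext x; simp
    have hd : Equiv.swap a b d = d := Equiv.swap_apply_of_ne_of_ne h4.symm h3.symm
    have he : Equiv.swap b d a = a := Equiv.swap_apply_of_ne_of_ne h1 h4
    rcases h2 (w a) with ha | ha <;> rcases h2 (w b) with hb | hb <;>
      rcases h2 (w d) with hw | hw <;>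
      simp [pairOp_basis, ha, hb, hw, hc, hd, he, smul_smul, hq, add_comm]
  · have hc : (w ∘ Equiv.swap a b) ∘ Equiv.swap a b = w := by ext x; simp
    have hd : Equiv.swap a b c = c := Equiv.swap_apply_of_ne_of_ne h3 h4.symm
    have he : Equiv.swap c a b = b := Equiv.swap_apply_of_ne_of_ne h4 h1.symm
    rcases h2 (w a) with ha | ha <;> rcases h2 (w b) with hb | hb <;>
      rcases h2 (w c) with hw | hw <;>
      simp [pairOp_basis, ha, hb, hw, hc, hd, he, smul_smul, hq, add_comm]

theorem pairOp_comm (q : k) {n : ℕ} (a b c d : Fin n)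
    (h1 : a ≠ c) (h2 : a ≠ d) (h3 : b ≠ c) (h4 : b ≠ d) :
    pairOp q a b * pairOp q c d = pairOp q c d * pairOp q a b := by
  refine (wordBasis q n).ext fun w => ?_
  have e1 : Equiv.swap a b c = c := Equiv.swap_apply_of_ne_of_ne h1.symm h3.symm
  have e2 : Equiv.swap a b d = d := Equiv.swap_apply_of_ne_of_ne h2.symm h4.symm
  have e3 : Equiv.swap c d a = a := Equiv.swap_apply_of_ne_of_ne h1 h2
  have e4 : Equiv.swap c d b = b := Equiv.swap_apply_of_ne_of_ne h3 h4
  have hc : (w ∘ Equiv.swap a b) ∘ Equiv.swap c d = (w ∘ Equiv.swap c d) ∘ Equiv.swap a b := by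
    ext x
    by_cases xa : x = a
    · subst xa; simp [e3, e4]
    by_cases xb : x = b
    · subst xb; simp [e3, e4]
    have ex : Equiv.swap a b x = x := Equiv.swap_apply_of_ne_of_ne xa xb
    by_cases xc : x = c
    · subst xc; simp [e1, e2]
    by_cases xd : x = d
    · subst xd; simp [e1, e2]
    have ey : Equiv.swap c d x = x := Equiv.swap_apply_of_ne_of_ne xc xd
    simp [ex, ey]
  by_cases hab : w a = w b <;> by_cases hcd : w c = w d <;>
    simp only [pairOp_basis, hab, hcd, e1, e2, e3, e4, hc, Module.End.mul_apply, map_add,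
      map_smul, map_zero, if_true, if_false, Function.comp_apply, smul_zero, add_zero]
  module

/-- The operator `μ^q(U_{i+1})`, which acts on the neighbouring factors `i` and `i + 1` (counted from
`0`). -/
def opU (q : k) {n : ℕ} (i : Fin (n - 1)) : Module.End k (TensorSpace q n) :=
  pairOp q (⟨i.val, by omega⟩ : Fin n) ⟨i.val + 1, by omega⟩

/-- The tensor space representation `μ^q` of `T_n(q)`. -/
def rep (q : k) [NeZero q] (n : ℕ) : TL q n →ₐ[k] Module.End k (TensorSpace q n) :=
  TL.lift q (opU q) (fun _ => pairOp_sq q (NeZero.ne q) _ _)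
    (fun i j h => pairOp_adj q (NeZero.ne q) _ _ _ _ (by
      simp only [Fin.mk.injEq, ne_eq]; omega))
    (fun i j h => by
      by_cases hij : i = j
      · rw [hij]
      · have : i.val ≠ j.val := fun h => hij (Fin.ext h)
        apply pairOp_comm <;> simp only [ne_eq, Fin.mk.injEq] <;> omega)

instance (q : k) [NeZero q] (n : ℕ) : Module (TL q n) (TensorSpace q n) :=
  Module.compHom _ (rep q n).toRingHom

theorem smul_def (q : k) [NeZero q] (n : ℕ) (a : TL q n) (v : TensorSpace q n) :
    a • v = rep q n a v := rfl

theorem U_smul (q : k) [NeZero q] {n : ℕ} (i : Fin (n - 1)) (v : TensorSpace q n) :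
    TL.U q i • v = opU q i v := by
  rw [smul_def]
  exact LinearMap.congr_fun (TL.lift_U q (opU q) _ _ _ i) v

instance (q : k) [NeZero q] (n : ℕ) : IsScalarTower k (TL q n) (TensorSpace q n) where
  smul_assoc c a v := by simp [smul_def]

end TensorSpace

/-- The number of letters `1` minus the number of letters `2` in a word (the letters `1`, `2` are
`0, 1 : Fin 2`). -/
def excess {n : ℕ} (w : Fin n → Fin 2) : ℤ :=
  ((Finset.univ.filter fun i => w i = 0).card : ℤ) -
    ((Finset.univ.filter fun i => w i = 1).card : ℤ)

theorem excess_comp {n : ℕ} (w : Fin n → Fin 2) (s : Equiv.Perm (Fin n)) :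
    excess (w ∘ s) = excess w := by
  have h : ∀ c : Fin 2, (Finset.univ.filter fun i => (w ∘ s) i = c).card =
      (Finset.univ.filter fun i => w i = c).card := by
    intro c
    refine Finset.card_bij (fun i _ => s i) ?_ ?_ ?_
    · intro i hi; simpa using hi
    · intro i _ j _ hij; exact s.injective hij
    · intro j hj; exact ⟨s.symm j, by simpa using hj, by simp⟩
  simp only [excess, h]

/-- The permutation submodule `M(s, n)` of `V^{⊗n}`: the `k`-span of the words of length `n` in which
the letter `1` occurs `s` times more often than the letter `2`. -/
def permModule (q : k) [NeZero q] (s : ℤ) (n : ℕ) : Submodule (TL q n) (TensorSpace q n) where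
  carrier := Submodule.span k (TensorSpace.wordBasis q n '' {w | excess w = s})
  add_mem' := Submodule.add_mem _
  zero_mem' := Submodule.zero_mem _
  smul_mem' := by
    intro a
    induction a using TL.induction with
    | halg c =>
      intro v hv
      rw [algebraMap_smul]
      exact Submodule.smul_mem _ c hv
    | hmul a b ha hb => intro v hv; rw [mul_smul]; exact ha (hb hv)
    | hadd a b ha hb => intro v hv; rw [add_smul]; exact Submodule.add_mem _ (ha hv) (hb hv)
    | hU i =>
      intro v hv
      rw [TensorSpace.U_smul]
      have : Submodule.span k (TensorSpace.wordBasis q n '' {w | excess w = s}) ≤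
          (Submodule.span k (TensorSpace.wordBasis q n '' {w | excess w = s})).comap
            (TensorSpace.opU q i) := by
        rw [Submodule.span_le]
        rintro _ ⟨w, hw, rfl⟩
        simp only [SetLike.mem_coe, Submodule.mem_comap, TensorSpace.opU, TensorSpace.pairOp_basis]
        split_ifs
        · exact Submodule.zero_mem _
        · refine Submodule.add_mem _ (Submodule.smul_mem _ _ (Submodule.subset_span ⟨w, hw, rfl⟩))
            (Submodule.subset_span ⟨_, ?_, rfl⟩)
          exact (excess_comp w _).trans hw
        · refine Submodule.add_mem _ (Submodule.smul_mem _ _ (Submodule.subset_span ⟨w, hw, rfl⟩))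
            (Submodule.subset_span ⟨_, ?_, rfl⟩)
          exact (excess_comp w _).trans hw
      exact this hv

/-! ### Localization, globalization and the adjunction map -/

namespace TL

variable (q : k) (n : ℕ)

/-- The inclusion `T_n(q) → T_{n+2}(q)` with `U_i ↦ U_i`. -/
def incl : TL q n →ₐ[k] TL q (n + 2) :=
  lift q (fun i => U q (n := n + 2) ⟨i.val, by omega⟩) (fun _ => U_sq q _)
    (fun _ _ h => U_adj q _ _ h) (fun _ _ h => U_comm q _ _ h)

/-- The idempotent `ε = [2]_q⁻¹ U_{n+1}` of `T_{n+2}(q)`. -/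
def eps : TL q (n + 2) := (qTwo q)⁻¹ • U q (n := n + 2) ⟨n, by omega⟩

theorem eps_comm (a : TL q n) : eps q n * incl q n a = incl q n a * eps q n := by
  induction a using TL.induction with
  | halg c => rw [AlgHom.commutes]; exact (Algebra.commutes c _).symm
  | hU i =>
    rw [incl, lift_U, eps, smul_mul_assoc, mul_smul_comm]
    congr 1
    exact U_comm q _ _ (by simp only; omega)
  | hmul a b ha hb => rw [map_mul, ← mul_assoc, ha, mul_assoc, hb, mul_assoc]
  | hadd a b ha hb => rw [map_add, mul_add, add_mul, ha, hb]

section Localization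

variable (M : Type w) [AddCommGroup M] [Module k M] [Module (TL q (n + 2)) M]
  [IsScalarTower k (TL q (n + 2)) M]

/-- The localization `F M = ε M` of a `T_{n+2}(q)`-module `M`. -/
def Loc : Type w := ↥(LinearMap.range (Algebra.lsmul k k M (eps q n)))

instance : AddCommGroup (Loc q n M) :=
  inferInstanceAs (AddCommGroup ↥(LinearMap.range (Algebra.lsmul k k M (eps q n))))

instance : Module k (Loc q n M) :=
  inferInstanceAs (Module k ↥(LinearMap.range (Algebra.lsmul k k M (eps q n))))

/-- The inclusion `ε M → M`. -/
def Loc.val : Loc q n M →ₗ[k] M :=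
  (LinearMap.range (Algebra.lsmul k k M (eps q n))).subtype

/-- `T_n(q)`, being a subalgebra of `T_{n+2}(q)` that commutes with `ε`, acts on `ε M`. -/
instance : Module (TL q n) (Loc q n M) where
  smul a x := ⟨incl q n a • Loc.val q n M x, by
    obtain ⟨y, m, rfl⟩ := x
    refine ⟨incl q n a • m, ?_⟩
    change eps q n • incl q n a • m = incl q n a • eps q n • m
    rw [← mul_smul, ← mul_smul, eps_comm]⟩
  one_smul x := Subtype.ext (by
    change incl q n 1 • Loc.val q n M x = Loc.val q n M x
    rw [map_one, one_smul])
  mul_smul a b x := Subtype.ext (by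
    change incl q n (a * b) • Loc.val q n M x = incl q n a • incl q n b • Loc.val q n M x
    rw [map_mul, mul_smul])
  smul_zero a := Subtype.ext (by
    change incl q n a • (0 : M) = 0
    rw [smul_zero])
  smul_add a x y := Subtype.ext (by
    change incl q n a • (Loc.val q n M x + Loc.val q n M y) =
      incl q n a • Loc.val q n M x + incl q n a • Loc.val q n M y
    rw [smul_add])
  add_smul a b x := Subtype.ext (by
    change incl q n (a + b) • Loc.val q n M x =
      incl q n a • Loc.val q n M x + incl q n b • Loc.val q n M x
    rw [map_add, add_smul])
  zero_smul x := Subtype.ext (by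
    change incl q n 0 • Loc.val q n M x = 0
    rw [map_zero, zero_smul])

theorem Loc.val_smul (a : TL q n) (x : Loc q n M) :
    Loc.val q n M (a • x) = incl q n a • Loc.val q n M x := rfl

end Localization

section Globalization

/-- The right action of `T_n(q)` on the left ideal `T_{n+2}(q) ε`. -/
def rightMul (x : ↥(Ideal.span {eps q n})) (a : TL q n) : ↥(Ideal.span {eps q n}) :=
  ⟨x.1 * incl q n a, by
    obtain ⟨b, hb⟩ := Ideal.mem_span_singleton'.1 x.2
    refine Ideal.mem_span_singleton'.2 ⟨b * incl q n a, ?_⟩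
    rw [← hb, mul_assoc, mul_assoc, eps_comm]⟩

variable (N : Type w) [AddCommGroup N] [Module k N] [Module (TL q n) N]

/-- The globalization `G N = T_{n+2}(q) ε ⊗_{T_n(q)} N` of a `T_n(q)`-module `N`: the quotient of the
tensor product over `k` by the relations `x a ⊗ y = x ⊗ a y` for `a` in `T_n(q)`. -/
abbrev Glob : Type (max u w) :=
  (↥(Ideal.span {eps q n}) ⊗[k] N) ⧸
    Submodule.span (TL q (n + 2)) {t : ↥(Ideal.span {eps q n}) ⊗[k] N |
      ∃ (x : ↥(Ideal.span {eps q n})) (a : TL q n) (y : N),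
        t = rightMul q n x a ⊗ₜ[k] y - x ⊗ₜ[k] (a • y)}

end Globalization

variable (M : Type w) [AddCommGroup M] [Module k M] [Module (TL q (n + 2)) M]
  [IsScalarTower k (TL q (n + 2)) M]

/-- The map `T_{n+2}(q) ε ⊗_k ε M → M`, `x ⊗ m ↦ x m`. -/
def mulMap : ↥(Ideal.span {eps q n}) ⊗[k] Loc q n M →ₗ[TL q (n + 2)] M :=
  TensorProduct.AlgebraTensorModule.lift
    { toFun := fun x => (Algebra.lsmul k k M x.1) ∘ₗ Loc.val q n M
      map_add' := fun x y => by ext m; simp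
      map_smul' := fun a x => by ext m; simp }

theorem mulMap_tmul (x : ↥(Ideal.span {eps q n})) (m : Loc q n M) :
    mulMap q n M (x ⊗ₜ[k] m) = x.1 • Loc.val q n M m := rfl

/-- The adjunction map `G (F M) → M`, the counit of the adjunction between `G` and `F`; it is given
by `x ⊗ m ↦ x m`. -/
def adjunctionMap : Glob q n (Loc q n M) →ₗ[TL q (n + 2)] M :=
  Submodule.liftQ _ (mulMap q n M) (by
    rw [Submodule.span_le]
    rintro _ ⟨x, a, y, rfl⟩
    simp only [SetLike.mem_coe, LinearMap.mem_ker, map_sub, mulMap_tmul, Loc.val_smul, rightMul,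
      mul_smul, sub_self])

end TL

end TemperleyLieb

end

/-!
A module `M` over `T_n` is filtered by the traces `N_l = ∑_{j ≥ l} T_n e_j M` of the heredity chain
(`TL.traceSubmodule`). When `e_l M` is at most one-dimensional modulo `N_{l+1}`, the layer
`N_l / N_{l+1}` is a quotient of `Δ(l)`, the standard module of weight `n - 2l`
(`TL.exists_surjective_layer`). For `M = M(2r - n, n)` this is a statement about words: modulo
`N_{l+1}`, the vectors `e_l w` are multiples of one another, because exchanging neighbouring
letters, either within one of the last `l` pairs or among the first `n - 2l` letters, changes
`e_l w` by a scalar (`IsSplit.isMultiple`); and `e_l M = 0` for `l > min(r, n - r)`.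

A dimension count shows that the surjections `Δ(l) → N_l / N_{l+1}` are isomorphisms. The module
`Δ(l)` has dimension at most the ballot number `binom(n, l) - binom(n, l - 1)`
(`TL.finrank_standard_le`), and these numbers sum to `binom(n, r) = dim M` for
`l ≤ min(r, n - r)` (`sum_ballot`). The bound is proved inside the presented algebra, without
a diagram basis: half-diagrams are sorted by whether their first point is a defect or is joined to
another point (`IsTLSequence.exists_spanning`), on the basis of the decomposition
`A_a = A_{a+1} + A_{a+1} u_a A_{a+1}` for the subalgebras `A_a` generated by the `u_i` with `i ≥ a`
(`IsTLSequence.tail_le`).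

The tensor space is the direct sum of the permutation modules. The generators act by symmetric
matrices in the basis of words, so orthogonal complements turn a standard filtration into
a costandard one (`HasFiltration.costandard_of_standard`).

The adjunction map is injective for every module with a standard filtration
(`TL.adjunctionMap_injective`). The induction along the filtration takes place in a fixed `G (F M)`,
in the images of the `G (F N)` for the members `N` of the filtration, and rests on
`ε T_{n+2} ε = ε T_n` (`TL.exists_eps_mul_mul_eps`).
-/

/-! ### Filtrations by layers -/

section Filtration

variable {A : Type*} [Ring A] {ι : Type*} (S : ι → Type*) [∀ i, AddCommGroup (S i)]
  [∀ i, Module A (S i)] {M : Type*} [AddCommGroup M] [Module A M]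

/-- The subquotient `N' / N` is isomorphic to `S i`, recorded as a surjection `N' → S i` with
kernel `N`. -/
def IsLayer (N N' : Submodule A M) (i : ι) : Prop :=
  N ≤ N' ∧ ∃ g : N' →ₗ[A] S i, Function.Surjective g ∧ ∀ x, g x = 0 ↔ (x : M) ∈ N

theorem isLayer_iff {N N' : Submodule A M} {i : ι} :
    IsLayer S N N' i ↔ N ≤ N' ∧ Nonempty ((↥N' ⧸ N.submoduleOf N') ≃ₗ[A] S i) := by
  refine and_congr_right fun _ => ⟨?_, ?_⟩
  · rintro ⟨g, hg, hk⟩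
    have : N.submoduleOf N' = LinearMap.ker g := by
      ext x
      rw [LinearMap.mem_ker, hk]
      rfl
    exact ⟨(Submodule.quotEquivOfEq _ _ this).trans (g.quotKerEquivOfSurjective hg)⟩
  · rintro ⟨f⟩
    refine ⟨f.toLinearMap ∘ₗ Submodule.mkQ _, f.surjective.comp (Submodule.mkQ_surjective _), ?_⟩
    intro x
    change f (Submodule.Quotient.mk x) = 0 ↔ _
    rw [LinearEquiv.map_eq_zero_iff, Submodule.Quotient.mk_eq_zero]
    rfl

/-- The submodules of `M` that are reached from `0` by finitely many layers. -/
inductive IsFiltered : Submodule A M → Prop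
  | bot : IsFiltered ⊥
  | step {N N' : Submodule A M} (i : ι) (hN : IsFiltered N) (h : IsLayer S N N' i) :
      IsFiltered N'

theorem hasFiltration_iff_layers : HasFiltration A S M ↔
    ∃ (m : ℕ) (N : Fin (m + 1) → Submodule A M), N 0 = ⊥ ∧ N (Fin.last m) = ⊤ ∧
      ∀ j : Fin m, ∃ i, IsLayer S (N j.castSucc) (N j.succ) i := by
  simp only [HasFiltration, isLayer_iff, exists_and_left]

variable {S} in
theorem IsFiltered.exists_chain {N : Submodule A M} (h : IsFiltered S N) :
    ∃ (m : ℕ) (C : Fin (m + 1) → Submodule A M), C 0 = ⊥ ∧ C (Fin.last m) = N ∧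
      ∀ j : Fin m, ∃ i, IsLayer S (C j.castSucc) (C j.succ) i := by
  induction h with
  | bot => exact ⟨0, fun _ => ⊥, rfl, rfl, fun j => j.elim0⟩
  | @step N N' i _ h ih =>
    obtain ⟨m, C, h0, h1, h2⟩ := ih
    refine ⟨m + 1, Fin.snoc C N', ?_, by simp, ?_⟩
    · rw [← Fin.castSucc_zero, Fin.snoc_castSucc, h0]
    · intro j
      refine Fin.lastCases ?_ (fun j => ?_) j
      · refine ⟨i, ?_⟩
        rw [Fin.snoc_castSucc, h1, Fin.succ_last, Fin.snoc_last]
        exact h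
      · rw [Fin.succ_castSucc, Fin.snoc_castSucc, Fin.snoc_castSucc]
        exact h2 j

theorem hasFiltration_iff_isFiltered_top :
    HasFiltration A S M ↔ IsFiltered S (⊤ : Submodule A M) := by
  rw [hasFiltration_iff_layers]
  refine ⟨?_, IsFiltered.exists_chain⟩
  rintro ⟨m, N, h0, h1, h2⟩
  rw [← h1]
  refine Fin.induction ?_ (fun j hj => ?_) (Fin.last m)
  · rw [h0]; exact .bot
  · obtain ⟨i, hi⟩ := h2 j
    exact .step i hj hi

variable {S}

/-- A filtration of `M'` continues a filtration of `P ≤ M` along a map `M' → M` that is injective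
modulo `P`. -/
theorem IsFiltered.sup_map {M' : Type*} [AddCommGroup M'] [Module A M'] (f : M' →ₗ[A] M)
    {P : Submodule A M} (hP : IsFiltered S P) (hf : ∀ x, f x ∈ P → x = 0)
    {N : Submodule A M'} (hN : IsFiltered S N) : IsFiltered S (P ⊔ N.map f) := by
  induction hN with
  | bot => simpa using hP
  | @step N N' i _ h ih =>
    refine .step i ih ?_
    rw [isLayer_iff]
    refine ⟨sup_le_sup_left (Submodule.map_mono h.1) _, ?_⟩
    obtain ⟨-, ⟨e⟩⟩ := (isLayer_iff S).1 h
    let g : N' →ₗ[A] ↥(P ⊔ N'.map f) :=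
      (f.comp N'.subtype).codRestrict _ fun x =>
        Submodule.mem_sup_right (Submodule.mem_map_of_mem x.2)
    let g' := ((P ⊔ N.map f).submoduleOf (P ⊔ N'.map f)).mkQ.comp g
    have hker : LinearMap.ker g' = N.submoduleOf N' := by
      ext x
      change Submodule.Quotient.mk (g x) = 0 ↔ (x : M') ∈ N
      rw [Submodule.Quotient.mk_eq_zero]
      change f x ∈ P ⊔ N.map f ↔ _
      constructor
      · intro hx
        obtain ⟨p, hp, _, ⟨y, hy, rfl⟩, hxy⟩ := Submodule.mem_sup.1 hx
        have := hf (x - y) (by rw [map_sub, ← hxy]; simpa using hp)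
        rw [sub_eq_zero.1 this]
        exact hy
      · intro hx
        exact Submodule.mem_sup_right (Submodule.mem_map_of_mem hx)
    have hsurj : Function.Surjective g' := by
      intro z
      obtain ⟨⟨z, hz⟩, rfl⟩ := Submodule.mkQ_surjective _ z
      obtain ⟨p, hp, _, ⟨y, hy, rfl⟩, rfl⟩ := Submodule.mem_sup.1 hz
      refine ⟨⟨y, hy⟩, ?_⟩
      simp only [g', LinearMap.comp_apply, Submodule.mkQ_apply]
      rw [Submodule.Quotient.eq]
      simp only [Submodule.submoduleOf, Submodule.mem_comap, Submodule.subtype_apply, g]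
      refine Submodule.mem_sup_left ?_
      simpa using hp
    exact ⟨(g'.quotKerEquivOfSurjective hsurj).symm.trans
      ((Submodule.quotEquivOfEq _ _ hker).trans e)⟩

end Filtration

/-! ### Duality between standard and costandard filtrations -/

section Duality

open MulOpposite (op unop)

theorem map_mem_higherIdeal {R R' ι : Type*} [Ring R] [Ring R'] [LT ι] (f : R →+* R') {e : ι → R}
    {e' : ι → R'} (he : ∀ i, f (e i) = e' i) {i : ι} {x : R} (hx : x ∈ higherIdeal e i) :
    f x ∈ higherIdeal e' i := by
  induction hx using Submodule.span_induction with
  | mem x h =>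
    obtain ⟨j, hj, a, rfl⟩ := h
    exact Ideal.subset_span ⟨j, hj, f a, by rw [map_mul, he]⟩
  | zero => simp
  | add x y _ _ hx hy => rw [map_add]; exact add_mem hx hy
  | smul a x _ hx => rw [smul_eq_mul, map_mul]; exact Ideal.mul_mem_left _ _ hx

theorem map_mem_span_singleton {R R' : Type*} [Ring R] [Ring R'] (f : R →+* R') {e x : R}
    (hx : x ∈ Ideal.span {e}) : f x ∈ Ideal.span {f e} := by
  obtain ⟨a, rfl⟩ := Ideal.mem_span_singleton'.1 hx
  rw [map_mul]
  exact Ideal.mul_mem_left _ _ (Ideal.mem_span_singleton_self _)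

variable {k : Type*} [Field k]

/-- An anti-automorphism of `A` that fixes the `e_i` identifies the standard module of the opposite
algebra with the standard module of `A`. -/
theorem exists_standard_op_equiv {A : Type*} [Ring A] [Algebra k A] {ι : Type*} [LT ι]
    (e : ι → A) (τ : Aᵐᵒᵖ ≃ₐ[k] A) (hτ : ∀ i, τ (op (e i)) = e i) (i : ι) :
    ∃ φ : Standard (fun j => op (e j)) i ≃ₗ[k] Standard e i, ∀ a x, φ (a • x) = τ a • φ x := by
  let σ : Aᵐᵒᵖ →+* A := τ.toAlgHom.toRingHom
  have hτ' : ∀ i, τ.symm (e i) = op (e i) := fun i => by rw [← hτ i, τ.symm_apply_apply, hτ i]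
  let L : ↥(Ideal.span {op (e i)}) →ₛₗ[σ] ↥(Ideal.span {e i}) :=
    { toFun := fun x => ⟨τ x.1, by
        have := map_mem_span_singleton σ x.2
        rwa [show σ (op (e i)) = e i from hτ i] at this⟩
      map_add' := fun x y => Subtype.ext (map_add τ x.1 y.1)
      map_smul' := fun a x => Subtype.ext (map_mul τ a x.1) }
  let φ : Standard (fun j => op (e j)) i →ₛₗ[σ] Standard e i :=
    Submodule.mapQ _ _ L fun x hx => map_mem_higherIdeal (e' := e) σ hτ hx
  have hinj : Function.Injective φ := by
    rw [injective_iff_map_eq_zero]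
    intro x hx
    obtain ⟨x, rfl⟩ := Submodule.mkQ_surjective _ x
    have hx' : τ x.1 ∈ higherIdeal e i := (Submodule.Quotient.mk_eq_zero
      (Submodule.submoduleOf (higherIdeal e i) (Ideal.span {e i})) (x := L x)).1 hx
    refine (Submodule.Quotient.mk_eq_zero _).2 ?_
    have := map_mem_higherIdeal (e' := fun j => op (e j)) τ.symm.toAlgHom.toRingHom hτ' hx'
    change τ.symm (τ x.1) ∈ _ at this
    rwa [τ.symm_apply_apply] at this
  have hsurj : Function.Surjective φ := by
    intro y
    obtain ⟨y, rfl⟩ := Submodule.mkQ_surjective _ y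
    have := map_mem_span_singleton τ.symm.toAlgHom.toRingHom y.2
    refine ⟨Submodule.Quotient.mk ⟨τ.symm y.1, ?_⟩, ?_⟩
    · change τ.symm y.1 ∈ Ideal.span {τ.symm (e i)} at this
      rwa [hτ'] at this
    · change Submodule.Quotient.mk _ = Submodule.Quotient.mk _
      congr 1
      exact Subtype.ext (τ.apply_symm_apply y.1)
  refine ⟨LinearEquiv.ofBijective
    { toFun := φ, map_add' := map_add φ, map_smul' := fun c x => ?_ } ⟨hinj, hsurj⟩,
    fun a x => φ.map_smulₛₗ a x⟩
  rw [← algebraMap_smul Aᵐᵒᵖ c x, φ.map_smulₛₗ]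
  change τ (algebraMap k _ c) • _ = _
  rw [AlgEquiv.commutes, algebraMap_smul]
  rfl

universe u v w

variable {k : Type u} [Field k] {A : Type u} [Ring A] [Algebra k A] {M : Type w} [AddCommGroup M]
  [Module k M] [Module A M]

/-- The orthogonal complement of a submodule with respect to a contravariant form. -/
def orthComplement (τ : Aᵐᵒᵖ ≃ₐ[k] A) (B : M ≃ₗ[k] Module.Dual k M)
    (hB : ∀ (a : A) x y, B (a • x) y = B x (τ (op a) • y)) (N : Submodule A M) :
    Submodule A M where
  carrier := {x | ∀ y ∈ N, B x y = 0}
  add_mem' hx hy z hz := by rw [map_add, LinearMap.add_apply, hx z hz, hy z hz, add_zero]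
  zero_mem' z _ := by rw [map_zero, LinearMap.zero_apply]
  smul_mem' a x hx y hy := by rw [hB]; exact hx _ (N.smul_mem _ hy)

variable [IsScalarTower k A M]

/-- A layer `N' / N ≅ Δ(i)` yields the layer `N^⊥ / N'^⊥ ≅ ∇(i)`. -/
theorem IsLayer.orthComplement {ι : Type v} [LT ι] {e : ι → A} {τ : Aᵐᵒᵖ ≃ₐ[k] A}
    (hτ : ∀ i, τ (op (e i)) = e i) {B : M ≃ₗ[k] Module.Dual k M}
    (hB : ∀ (a : A) x y, B (a • x) y = B x (τ (op a) • y)) {N N' : Submodule A M} {i : ι}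
    (h : IsLayer (fun i => Standard e i) N N' i) :
    IsLayer (fun i => Costandard k e i) (orthComplement τ B hB N') (orthComplement τ B hB N) i := by
  obtain ⟨hN, g, hg, hk⟩ := h
  obtain ⟨φ, hφ⟩ := exists_standard_op_equiv (k := k) e τ hτ i
  refine ⟨fun x hx y hy => hx y (hN hy), ?_⟩
  -- A `k`-linear section `s` of `g` expresses the pairing of `N^⊥` with `Δ(i)`.
  obtain ⟨s, hs⟩ := (g.restrictScalars k).exists_rightInverse_of_surjective
    (LinearMap.range_eq_top.2 hg)
  replace hs : ∀ z, g (s z) = z := fun z => LinearMap.congr_fun hs z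
  have hpair : ∀ x ∈ _root_.orthComplement τ B hB N, ∀ y y' : N', g y = g y' → B x y = B x y' := by
    intro x hx y y' hy
    rw [← sub_eq_zero, ← map_sub]
    refine hx _ ((hk (y - y')).1 ?_)
    rw [map_sub, hy, sub_self]
  let G : _root_.orthComplement τ B hB N →ₗ[A] Costandard k e i :=
    { toFun := fun x => (B x.1 ∘ₗ (N'.subtype.restrictScalars k)) ∘ₗ s ∘ₗ φ.toLinearMap
      map_add' := fun x y => Costandard.ext k e i fun z => by
        change B (x.1 + y.1) _ = B x.1 _ + B y.1 _
        rw [map_add]; rfl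
      map_smul' := fun a x => Costandard.ext k e i fun z => by
        change B (a • x.1) (s (φ z) : N').1 = B x.1 (s (φ (op a • z)) : N').1
        rw [hB]
        refine hpair x.1 x.2 (τ (op a) • s (φ z)) _ ?_
        rw [map_smul, hs, hs, hφ] }
  have hG : ∀ x z, G x z = B x.1 (s (φ z) : N').1 := fun _ _ => rfl
  refine ⟨G, fun f => ?_, fun x => ⟨fun hx y hy => ?_, fun hx => ?_⟩⟩
  · -- A functional on `N' / N` extends to `M`, where it is represented by some `x`.
    let f' : N' →ₗ[k] k :=
      (show Standard (fun j => op (e j)) i →ₗ[k] k from f) ∘ₗ φ.symm.toLinearMap ∘ₗ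
        g.restrictScalars k
    have hf' : ∀ y, f' y = f (φ.symm (g y)) := fun _ => rfl
    obtain ⟨F, hF⟩ := LinearMap.exists_extend (p := N'.restrictScalars k) f'
    replace hF : ∀ y : N', F y = f' y := fun y => LinearMap.congr_fun hF y
    refine ⟨⟨B.symm F, fun y hy => ?_⟩, Costandard.ext k e i fun z => ?_⟩
    · rw [B.apply_symm_apply]
      refine (hF ⟨y, hN hy⟩).trans ?_
      rw [hf', (hk _).2 hy, map_zero, Costandard.map_zero]
    · rw [hG]
      simp only [B.apply_symm_apply]
      rw [hF, hf', hs, φ.symm_apply_apply]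
  · have h1 := hG x (φ.symm (g ⟨y, hy⟩))
    rw [φ.apply_symm_apply, hx] at h1
    rw [hpair x.1 x.2 ⟨y, hy⟩ _ (hs _).symm, ← h1]
    rfl
  · refine Costandard.ext k e i fun z => ?_
    rw [hG]
    exact hx _ (s (φ z)).2

/-- Under a contravariant form, the orthogonal complements of the members of a standard filtration
form a costandard filtration. -/
theorem HasFiltration.costandard_of_standard {ι : Type v} [LT ι] {e : ι → A} {τ : Aᵐᵒᵖ ≃ₐ[k] A}
    (hτ : ∀ i, τ (op (e i)) = e i) {B : M ≃ₗ[k] Module.Dual k M}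
    (hB : ∀ (a : A) x y, B (a • x) y = B x (τ (op a) • y))
    (h : HasFiltration A (fun i => Standard e i) M) :
    HasFiltration A (fun i => Costandard k e i) M := by
  rw [hasFiltration_iff_layers] at h ⊢
  obtain ⟨m, N, h0, h1, h2⟩ := h
  refine ⟨m, fun j => orthComplement τ B hB (N j.rev), ?_, ?_, fun j => ?_⟩
  · beta_reduce
    rw [Fin.rev_zero, h1, eq_bot_iff]
    intro x hx
    have : B x = 0 := LinearMap.ext fun y => hx y trivial
    simpa using this
  · beta_reduce
    rw [Fin.rev_last, h0, eq_top_iff]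
    intro x _ y hy
    rw [(Submodule.mem_bot A).1 hy, map_zero]
  · obtain ⟨i, hi⟩ := h2 j.rev
    refine ⟨i, ?_⟩
    beta_reduce
    rw [Fin.rev_castSucc, Fin.rev_succ]
    exact hi.orthComplement hτ hB

end Duality

/-! ### Sequences satisfying the Temperley–Lieb relations -/

section TLSequence

variable {k : Type*} [Field k] {B : Type*} [Ring B] [Algebra k B]

/-- An eventually zero sequence in `B` that satisfies the Temperley–Lieb relations. The relation
`u i * u (i + 1) * u i = u i` fails at the last nonzero term, so it is only required up to a
scalar. -/
structure IsTLSequence (δ : k) (u : ℕ → B) : Prop where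
  sq : ∀ i, u i * u i = δ • u i
  adj_right : ∀ i, ∃ c : k, u i * u (i + 1) * u i = c • u i
  adj_left : ∀ i, u (i + 1) * u i * u (i + 1) = u (i + 1)
  comm : ∀ i j, i + 2 ≤ j → u i * u j = u j * u i
  eventually_zero : ∃ L, ∀ i ≥ L, u i = 0

variable (k) in
/-- The subalgebra generated by the `u i` with `i ≥ a`. -/
def tailAlgebra (u : ℕ → B) (a : ℕ) : Subalgebra k B := Algebra.adjoin k (u '' Set.Ici a)

theorem mem_tailAlgebra {u : ℕ → B} {a i : ℕ} (h : a ≤ i) : u i ∈ tailAlgebra k u a :=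
  Algebra.subset_adjoin ⟨i, h, rfl⟩

theorem tailAlgebra_anti {u : ℕ → B} {a b : ℕ} (h : a ≤ b) :
    tailAlgebra k u b ≤ tailAlgebra k u a :=
  Algebra.adjoin_mono (Set.image_mono (Set.Ici_subset_Ici.2 h))

/-- A subspace that is stable under the generators of a tail algebra is stable under the algebra. -/
theorem tailAlgebra_mul_mem {u : ℕ → B} {a : ℕ} {Y : Submodule k B}
    (hY : ∀ i ≥ a, ∀ y ∈ Y, u i * y ∈ Y) {t y : B} (ht : t ∈ tailAlgebra k u a) (hy : y ∈ Y) :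
    t * y ∈ Y := by
  induction ht using Algebra.adjoin_induction generalizing y with
  | mem x hx => obtain ⟨i, hi, rfl⟩ := hx; exact hY i hi y hy
  | algebraMap r => rw [← Algebra.smul_def]; exact Y.smul_mem _ hy
  | add s t _ _ hs ht => rw [add_mul]; exact add_mem (hs hy) (ht hy)
  | mul s t _ _ hs ht => rw [mul_assoc]; exact hs (ht hy)

namespace IsTLSequence

variable {δ : k} {u : ℕ → B}

theorem commute_tail (hu : IsTLSequence δ u) {i : ℕ} {t : B} (ht : t ∈ tailAlgebra k u (i + 2)) :
    Commute (u i) t := by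
  induction ht using Algebra.adjoin_induction with
  | mem x hx => obtain ⟨j, hj, rfl⟩ := hx; exact hu.comm i j hj
  | algebraMap r => exact (Algebra.commutes r _).symm
  | add s t _ _ hs ht => exact hs.add_right ht
  | mul s t _ _ hs ht => exact hs.mul_right ht

/-- `A_a = A_{a+1} + A_{a+1} u_a A_{a+1}` for the tail algebras `A_a`, stated as an induction
principle for membership in a subspace. -/
theorem tail_le (hu : IsTLSequence δ u) (a : ℕ) {X : Submodule k B}
    (h1 : ∀ s ∈ tailAlgebra k u (a + 1), s ∈ X)
    (h2 : ∀ s ∈ tailAlgebra k u (a + 1), ∀ s' ∈ tailAlgebra k u (a + 1), s * u a * s' ∈ X)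
    {t : B} (ht : t ∈ tailAlgebra k u a) : t ∈ X := by
  obtain ⟨L, hL⟩ := hu.eventually_zero
  obtain ⟨n, hn⟩ : ∃ n, L ≤ a + n := ⟨L, by omega⟩
  induction n generalizing a X t with
  | zero =>
    refine h1 t ?_
    induction ht using Algebra.adjoin_induction with
    | mem x hx =>
      obtain ⟨i, hi, rfl⟩ := hx
      have : a ≤ i := hi
      rw [hL i (by omega)]
      exact zero_mem _
    | algebraMap r => exact Subalgebra.algebraMap_mem _ r
    | add s t _ _ hs ht => exact add_mem hs ht
    | mul s t _ _ hs ht => exact mul_mem hs ht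
  | succ n ih =>
    let R : Submodule k B := Submodule.span k ({x | x ∈ tailAlgebra k u (a + 1)} ∪
      {x | ∃ s ∈ tailAlgebra k u (a + 1), ∃ s' ∈ tailAlgebra k u (a + 1), x = s * u a * s'})
    have hR1 : ∀ s ∈ tailAlgebra k u (a + 1), s ∈ R := fun s hs =>
      Submodule.subset_span (Or.inl hs)
    have hR2 : ∀ s ∈ tailAlgebra k u (a + 1), ∀ s' ∈ tailAlgebra k u (a + 1),
        s * u a * s' ∈ R := fun s hs s' hs' => Submodule.subset_span (Or.inr ⟨s, hs, s', hs', rfl⟩)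
    have hRX : R ≤ X := by
      refine Submodule.span_le.2 ?_
      rintro x (hx | ⟨s, hs, s', hs', rfl⟩)
      · exact h1 x hx
      · exact h2 s hs s' hs'
    refine hRX ?_
    rw [← mul_one t]
    refine tailAlgebra_mul_mem (a := a) ?_ ht (hR1 1 (one_mem _))
    intro i hi y hy
    suffices R ≤ R.comap (LinearMap.mulLeft k (u i)) from this hy
    have anti := tailAlgebra_anti (k := k) (u := u) (Nat.le_succ (a + 1))
    refine Submodule.span_le.2 ?_
    rintro x (hx | ⟨s, hs, s', hs', rfl⟩)
    · change u i * x ∈ R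
      rcases Nat.eq_or_lt_of_le hi with rfl | hi
      · simpa using hR2 1 (one_mem _) x hx
      · exact hR1 _ (mul_mem (mem_tailAlgebra hi) hx)
    · change u i * (s * u a * s') ∈ R
      rcases Nat.eq_or_lt_of_le hi with rfl | hi
      · -- `u_a s u_a` lies in `A_{a+2} u_a`, by the decomposition of `A_{a+1}`.
        rw [mul_assoc]
        refine show s ∈ R.comap (LinearMap.mulLeft k (u a) ∘ₗ LinearMap.mulRight k (u a * s'))
          from ih (a + 1) ?_ ?_ hs (by omega)
        · intro s hs
          change u a * (s * (u a * s')) ∈ R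
          rw [← mul_assoc, (hu.commute_tail hs).eq, mul_assoc, ← mul_assoc (u a), hu.sq,
            smul_mul_assoc, mul_smul_comm, ← mul_assoc]
          exact R.smul_mem _ (hR2 _ (anti hs) _ hs')
        · intro s1 hs1 s2 hs2
          change u a * (s1 * u (a + 1) * s2 * (u a * s')) ∈ R
          obtain ⟨c, hc⟩ := hu.adj_right a
          have : u a * (s1 * u (a + 1) * s2 * (u a * s')) = c • (s1 * u a * (s2 * s')) := by
            calc _ = (u a * s1) * u (a + 1) * (s2 * u a) * s' := by noncomm_ring
              _ = s1 * (u a * u (a + 1) * u a) * (s2 * s') := by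
                rw [(hu.commute_tail hs1).eq, ← (hu.commute_tail hs2).eq]; noncomm_ring
              _ = _ := by rw [hc, mul_smul_comm, smul_mul_assoc]
          rw [this]
          exact R.smul_mem _ (hR2 _ (anti hs1) _ (mul_mem (anti hs2) hs'))
      · rw [← mul_assoc, ← mul_assoc]
        exact hR2 _ (mul_mem (mem_tailAlgebra hi) hs) _ hs'

theorem map_mem_of_tail (hu : IsTLSequence δ u) {a : ℕ} (f : B →ₗ[k] B) {X : Submodule k B}
    (h1 : ∀ s ∈ tailAlgebra k u (a + 1), f s ∈ X)
    (h2 : ∀ s ∈ tailAlgebra k u (a + 1), ∀ s' ∈ tailAlgebra k u (a + 1), f (s * u a * s') ∈ X)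
    {t : B} (ht : t ∈ tailAlgebra k u a) : f t ∈ X :=
  hu.tail_le a (X := X.comap f) h1 h2 ht

theorem exists_corner_succ (hu : IsTLSequence δ u) (a : ℕ) {t : B}
    (ht : t ∈ tailAlgebra k u (a + 1)) :
    ∃ s ∈ tailAlgebra k u (a + 2), u a * t * u a = u a * s := by
  let X : Submodule k B := ((tailAlgebra k u (a + 2)).toSubmodule.map
    (LinearMap.mulLeft k (u a))).comap (LinearMap.mulLeft k (u a) ∘ₗ LinearMap.mulRight k (u a))
  suffices t ∈ X by
    obtain ⟨s, hs, h⟩ := this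
    exact ⟨s, hs, (mul_assoc _ _ _).trans h.symm⟩
  refine hu.tail_le (a + 1) ?_ ?_ ht
  · intro s hs
    refine ⟨δ • s, Subalgebra.smul_mem _ hs δ, ?_⟩
    change u a * (δ • s) = u a * (s * u a)
    rw [← (hu.commute_tail hs).eq, ← mul_assoc, hu.sq, smul_mul_assoc, mul_smul_comm]
  · intro s hs s' hs'
    obtain ⟨c, hc⟩ := hu.adj_right a
    refine ⟨c • (s * s'), Subalgebra.smul_mem _ ((tailAlgebra k u (a + 2)).mul_mem hs hs') c, ?_⟩
    change u a * (c • (s * s')) = u a * (s * u (a + 1) * s' * u a)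
    symm
    calc _ = (u a * s) * u (a + 1) * (s' * u a) := by noncomm_ring
      _ = s * (u a * u (a + 1) * u a) * s' := by
        rw [(hu.commute_tail hs).eq, ← (hu.commute_tail hs').eq]; noncomm_ring
      _ = c • ((s * u a) * s') := by rw [hc, mul_smul_comm, smul_mul_assoc]
      _ = _ := by rw [← (hu.commute_tail hs).eq, mul_assoc, mul_smul_comm]

/-- `u_a A_a u_a ⊆ u_a A_{a+2}`. -/
theorem exists_corner (hu : IsTLSequence δ u) (a : ℕ) {t : B} (ht : t ∈ tailAlgebra k u a) :
    ∃ s ∈ tailAlgebra k u (a + 2), u a * t * u a = u a * s := by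
  let X : Submodule k B := ((tailAlgebra k u (a + 2)).toSubmodule.map
    (LinearMap.mulLeft k (u a))).comap (LinearMap.mulLeft k (u a) ∘ₗ LinearMap.mulRight k (u a))
  suffices t ∈ X by
    obtain ⟨s, hs, h⟩ := this
    exact ⟨s, hs, (mul_assoc _ _ _).trans h.symm⟩
  refine hu.tail_le a ?_ ?_ ht
  · intro s hs
    obtain ⟨r, hr, h⟩ := hu.exists_corner_succ a hs
    exact ⟨r, hr, (h.symm.trans (mul_assoc _ _ _))⟩
  · intro s hs s' hs'
    obtain ⟨r, hr, h⟩ := hu.exists_corner_succ a hs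
    obtain ⟨r', hr', h'⟩ := hu.exists_corner_succ a hs'
    refine ⟨r * r', (tailAlgebra k u (a + 2)).mul_mem hr hr', ?_⟩
    change u a * (r * r') = u a * (s * u a * s' * u a)
    symm
    calc _ = (u a * s * u a) * s' * u a := by noncomm_ring
      _ = r * (u a * s' * u a) := by rw [h, (hu.commute_tail hr).eq]; noncomm_ring
      _ = _ := by rw [h', ← mul_assoc, ← (hu.commute_tail hr).eq, mul_assoc]

/-! ### Spanning sets of cyclic modules generated by half-diagrams -/

variable (k u) in
/-- The subspace `A_a x + Y`. -/
def orbit (a : ℕ) (x : B) (Y : Submodule k B) : Submodule k B :=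
  (tailAlgebra k u a).toSubmodule.map (LinearMap.mulRight k x) ⊔ Y

theorem mul_mem_orbit {a : ℕ} {t : B} (x : B) (Y : Submodule k B) (ht : t ∈ tailAlgebra k u a) :
    t * x ∈ orbit k u a x Y := Submodule.mem_sup_left ⟨t, ht, rfl⟩

theorem self_mem_orbit (a : ℕ) (x : B) (Y : Submodule k B) : x ∈ orbit k u a x Y := by
  simpa using mul_mem_orbit x Y (one_mem (tailAlgebra k u a))

theorem le_orbit (a : ℕ) (x : B) (Y : Submodule k B) : Y ≤ orbit k u a x Y := le_sup_right

theorem orbit_le {a : ℕ} {x : B} {Y Z : Submodule k B} (hY : Y ≤ Z)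
    (h : ∀ t ∈ tailAlgebra k u a, t * x ∈ Z) : orbit k u a x Y ≤ Z := by
  refine sup_le ?_ hY
  rintro _ ⟨t, ht, rfl⟩
  exact h t ht

theorem orbit_stable {a b : ℕ} (hab : a ≤ b) {x : B} {Y : Submodule k B}
    (hY : ∀ i ≥ b, ∀ y ∈ Y, u i * y ∈ Y) :
    ∀ i ≥ b, ∀ y ∈ orbit k u a x Y, u i * y ∈ orbit k u a x Y := by
  intro i hi y hy
  obtain ⟨_, ⟨t, ht, rfl⟩, z, hz, rfl⟩ := Submodule.mem_sup.1 hy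
  rw [mul_add]
  refine add_mem ?_ (le_orbit _ _ _ (hY i hi z hz))
  change u i * (t * x) ∈ _
  rw [← mul_assoc]
  exact mul_mem_orbit _ _ (mul_mem (mem_tailAlgebra (hab.trans hi)) ht)

/-- If the points `a` and `a + 1` are joined in `x`, then `u_a` is not needed to generate
`A_a x`. -/
theorem mul_mem_orbit_of_joined (hu : IsTLSequence δ u) (hδ : δ ≠ 0) {a : ℕ} {x : B}
    {Y : Submodule k B} (hY : ∀ i ≥ a, ∀ y ∈ Y, u i * y ∈ Y) (hx : u a * x - δ • x ∈ Y) {t : B}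
    (ht : t ∈ tailAlgebra k u a) : t * x ∈ orbit k u (a + 1) x Y := by
  have hst : ∀ t ∈ tailAlgebra k u (a + 1), ∀ y ∈ orbit k u (a + 1) x Y,
      t * y ∈ orbit k u (a + 1) x Y := fun t ht y hy =>
    tailAlgebra_mul_mem (orbit_stable le_rfl fun i hi => hY i (by omega)) ht hy
  have hY' : ∀ t ∈ tailAlgebra k u a, ∀ y ∈ Y, t * y ∈ Y := fun t ht y hy =>
    tailAlgebra_mul_mem hY ht hy
  have anti1 := tailAlgebra_anti (k := k) (u := u) (Nat.le_succ a)
  have anti := tailAlgebra_anti (k := k) (u := u) (Nat.le_succ (a + 1))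
  have hux : u a * x ∈ orbit k u (a + 1) x Y := by
    rw [← sub_add_cancel (u a * x) (δ • x)]
    exact add_mem (le_orbit _ _ _ hx) (Submodule.smul_mem _ _ (self_mem_orbit _ _ _))
  have key : ∀ s ∈ tailAlgebra k u (a + 1), u a * (s * x) ∈ orbit k u (a + 1) x Y := by
    intro s hs
    refine hu.map_mem_of_tail (LinearMap.mulLeft k (u a) ∘ₗ LinearMap.mulRight k x) ?_ ?_ hs
    · intro s hs
      change u a * (s * x) ∈ _
      rw [← mul_assoc, (hu.commute_tail hs).eq, mul_assoc]
      exact hst _ (anti hs) _ hux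
    · intro s hs s' hs'
      change u a * (s * u (a + 1) * s' * x) ∈ _
      obtain ⟨c, hc⟩ := hu.adj_right a
      -- Replace `δ x` by `u_a x` and apply `u_a u_{a+1} u_a = c u_a`.
      have : δ • (u a * (s * u (a + 1) * s' * x)) = c • (s * (s' * (u a * x))) -
          u a * (s * u (a + 1) * s') * (u a * x - δ • x) := by
        have h3 : u a * (s * u (a + 1) * s') * (u a * x) = c • (s * (s' * (u a * x))) := by
          calc _ = (u a * s) * u (a + 1) * (s' * u a) * x := by noncomm_ring
            _ = s * (u a * u (a + 1) * u a) * (s' * x) := by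
              rw [(hu.commute_tail hs).eq, ← (hu.commute_tail hs').eq]; noncomm_ring
            _ = c • (s * (u a * s') * x) := by
              rw [hc, mul_smul_comm, smul_mul_assoc]; congr 1; noncomm_ring
            _ = _ := by rw [(hu.commute_tail hs').eq]; congr 1; noncomm_ring
        rw [mul_sub, h3, sub_sub_cancel, mul_smul_comm, ← mul_assoc (u a)]
      rw [← Submodule.smul_mem_iff _ hδ, this]
      refine sub_mem (Submodule.smul_mem _ _ ?_) (le_orbit _ _ _ (hY' _ ?_ _ hx))
      · exact hst _ (anti hs) _ (hst _ (anti hs') _ hux)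
      · exact mul_mem (mem_tailAlgebra le_rfl) (mul_mem (mul_mem (anti1 (anti hs))
          (mem_tailAlgebra (Nat.le_succ a))) (anti1 (anti hs')))
  refine hu.map_mem_of_tail (LinearMap.mulRight k x) ?_ ?_ ht
  · intro s hs
    exact mul_mem_orbit _ _ hs
  · intro s hs s' hs'
    change s * u a * s' * x ∈ _
    rw [mul_assoc, mul_assoc]
    exact hst s hs _ (key s' hs')

variable (u) in
/-- The product `u_a u_{a+1} ⋯ u_{a+j-1}`. -/
def run (a : ℕ) : ℕ → B
  | 0 => 1
  | j + 1 => run a j * u (a + j)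

theorem run_add (a i j : ℕ) : run u a (i + j) = run u a i * run u (a + i) j := by
  induction j with
  | zero => simp [run]
  | succ j ih => rw [← add_assoc, run, ih, run, mul_assoc, add_assoc]

theorem run_mem (a j : ℕ) : run u a j ∈ tailAlgebra k u a := by
  induction j with
  | zero => exact one_mem _
  | succ j ih => exact mul_mem ih (mem_tailAlgebra (by omega))

theorem commute_run (hu : IsTLSequence δ u) {a j i : ℕ} (h : a + j + 1 ≤ i) :
    Commute (run u a j) (u i) := by
  induction j with
  | zero => exact Commute.one_left _
  | succ j ih => exact (ih (by omega)).mul_left (hu.comm _ _ (by omega))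

theorem commute_run_tail (hu : IsTLSequence δ u) {a j b : ℕ} (hb : a + j + 1 ≤ b) {t : B}
    (ht : t ∈ tailAlgebra k u b) : Commute (run u a j) t := by
  induction ht using Algebra.adjoin_induction with
  | mem x hx => obtain ⟨i, hi, rfl⟩ := hx; exact hu.commute_run (hb.trans hi)
  | algebraMap r => exact (Algebra.commutes r _).symm
  | add s t _ _ hs ht => exact hs.add_right ht
  | mul s t _ _ hs ht => exact hs.mul_right ht

/-- In a half-diagram generated from `x`, with defects at `a, …, a + m` followed by an arc, the
point `a` is a defect (and the half-diagram is generated by `A_{a+1}`), or it is joined to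
a point, which the generator `u_a ⋯ u_{a+m} x` accounts for. -/
theorem mul_mem_of_run (hu : IsTLSequence δ u) (hδ : δ ≠ 0) {a m : ℕ} {x : B}
    {Y Z : Submodule k B} (hY : ∀ i ≥ a, ∀ y ∈ Y, u i * y ∈ Y) (hYZ : Y ≤ Z)
    (hZ : ∀ i ≥ a + 1, ∀ y ∈ Z, u i * y ∈ Z)
    (hx : ∀ i, a ≤ i → i < a + m → u i * x ∈ Y) (hx' : u (a + m + 1) * x - δ • x ∈ Y)
    (hxZ : x ∈ Z) (hrZ : run u a (m + 1) * x ∈ Z) {t : B} (ht : t ∈ tailAlgebra k u a) :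
    t * x ∈ Z := by
  have hY' : ∀ t ∈ tailAlgebra k u a, ∀ y ∈ Y, t * y ∈ Y := fun t ht y hy =>
    tailAlgebra_mul_mem hY ht hy
  have hZ' : ∀ t ∈ tailAlgebra k u (a + 1), ∀ y ∈ Z, t * y ∈ Z := fun t ht y hy =>
    tailAlgebra_mul_mem hZ ht hy
  have claim : ∀ d j, j + d = m → ∀ t ∈ tailAlgebra k u (a + j + 1),
      run u a (j + 1) * (t * x) ∈ Z := by
    intro d
    induction d with
    | zero =>
      rintro j rfl t ht
      have h := hu.mul_mem_orbit_of_joined hδ (fun i hi => hY i (by omega)) hx' ht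
      obtain ⟨_, ⟨s, hs, rfl⟩, y, hy, h⟩ := Submodule.mem_sup.1 h
      rw [← h, mul_add]
      refine add_mem ?_ (hYZ (hY' _ (run_mem _ _) _ hy))
      change run u a (j + 1) * (s * x) ∈ Z
      rw [← mul_assoc, (hu.commute_run_tail (by omega) hs).eq, mul_assoc]
      exact hZ' _ (tailAlgebra_anti (by omega) hs) _ hrZ
    | succ d ih =>
      intro j hj t ht
      refine hu.map_mem_of_tail (LinearMap.mulLeft k (run u a (j + 1)) ∘ₗ
        LinearMap.mulRight k x) ?_ ?_ ht
      · intro s hs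
        change run u a (j + 1) * (s * x) ∈ Z
        rw [← mul_assoc, (hu.commute_run_tail (by omega) hs).eq, mul_assoc, run, mul_assoc]
        exact hYZ (hY' _ (tailAlgebra_anti (by omega) hs) _
          (hY' _ (run_mem _ _) _ (hx _ (by omega) (by omega))))
      · intro s hs s' hs'
        change run u a (j + 1) * (s * u (a + j + 1) * s' * x) ∈ Z
        have : run u a (j + 1) * (s * u (a + j + 1) * s' * x) =
            s * (run u a (j + 1 + 1) * (s' * x)) := by
          rw [show run u a (j + 1 + 1) = run u a (j + 1) * u (a + (j + 1)) from rfl]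
          calc _ = run u a (j + 1) * s * u (a + j + 1) * s' * x := by noncomm_ring
            _ = _ := by rw [(hu.commute_run_tail (by omega) hs).eq, ← add_assoc]; noncomm_ring
        rw [this]
        exact hZ' _ (tailAlgebra_anti (by omega) hs) _ (ih (j + 1) (by omega) _ hs')
  refine hu.map_mem_of_tail (LinearMap.mulRight k x) ?_ ?_ ht
  · intro s hs
    exact hZ' s hs x hxZ
  · intro s hs s' hs'
    change s * u a * s' * x ∈ Z
    have := hZ' s hs _ (claim m 0 (by omega) s' hs')
    simpa [run, mul_assoc] using this

/-- Multiplication by `u_{a+p}` shortens the run `u_a ⋯ u_{a+j-1}`. -/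
theorem mul_run (hu : IsTLSequence δ u) (a : ℕ) {p j : ℕ} (h : p + 1 < j) :
    u (a + p + 1) * run u a j = run u (a + p + 1) (j - p - 1) * run u a p := by
  obtain ⟨r, rfl⟩ : ∃ r, j = p + 2 + r := ⟨j - p - 2, by omega⟩
  have h1 : ∀ r, Commute (run u (a + p + 1) r) (run u a p) := by
    intro r
    exact (hu.commute_run_tail le_rfl (run_mem _ _)).symm
  rw [run_add, show p + 2 + r - p - 1 = 1 + r by omega, (h1 _).eq, run_add (a + p + 1)]
  simp only [run, add_zero, one_mul]
  have h2 : u (a + p + 1) * run u a p = run u a p * u (a + p + 1) :=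
    (hu.commute_run (by omega)).eq.symm
  calc _ = (u (a + p + 1) * run u a p) * u (a + p) * u (a + p + 1) * run u (a + (p + 2)) r := by
        noncomm_ring
    _ = run u a p * (u (a + p + 1) * u (a + p) * u (a + p + 1)) * run u (a + (p + 2)) r := by
        rw [h2]; noncomm_ring
    _ = _ := by rw [hu.adj_left, mul_assoc, ← add_assoc]

end IsTLSequence

/-- The number of half-diagrams with `m` defects and `l` arcs, that is, of non-crossing matchings of
`l` pairs among `m + 2l` points on a line in which no unmatched point (defect) lies under an arc.
The recursion removes the first point. -/
def ballot : ℕ → ℕ → ℕ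
  | _, 0 => 1
  | 0, l + 1 => ballot 1 l
  | m + 1, l + 1 => ballot m (l + 1) + ballot (m + 2) l
termination_by m l => (l, m)

theorem ballot_zero (m : ℕ) : ballot m 0 = 1 := by
  unfold ballot; cases m <;> rfl

theorem ballot_add_choose (m l : ℕ) :
    ballot m (l + 1) + (m + 2 * (l + 1)).choose l = (m + 2 * (l + 1)).choose (l + 1) := by
  match m, l with
  | 0, 0 => simp [ballot]
  | 0, l + 1 =>
    have h1 := ballot_add_choose 1 l
    have h2 := Nat.choose_succ_succ' (2 * l + 3) l
    have h3 := Nat.choose_succ_succ' (2 * l + 3) (l + 1)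
    have h4 := Nat.choose_symm_of_eq_add (show 2 * l + 3 = (l + 1) + (l + 1 + 1) by ring)
    rw [show 1 + 2 * (l + 1) = 2 * l + 3 by ring] at h1
    rw [ballot, show 0 + 2 * (l + 1 + 1) = 2 * l + 3 + 1 by ring]
    omega
  | m + 1, 0 =>
    have h1 := ballot_add_choose m 0
    simp only [ballot, ballot_zero, Nat.choose_zero_right, zero_add, Nat.choose_one_right] at h1 ⊢
    omega
  | m + 1, l + 1 =>
    have h1 := ballot_add_choose m (l + 1)
    have h2 := ballot_add_choose (m + 2) l
    have h3 := Nat.choose_succ_succ' (m + 2 * l + 4) l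
    have h4 := Nat.choose_succ_succ' (m + 2 * l + 4) (l + 1)
    rw [show m + 2 * (l + 1 + 1) = m + 2 * l + 4 by ring] at h1
    rw [show m + 2 + 2 * (l + 1) = m + 2 * l + 4 by ring] at h2
    rw [ballot, show m + 1 + 2 * (l + 1 + 1) = m + 2 * l + 4 + 1 by ring]
    omega
termination_by (l, m)

theorem sum_ballot (n r : ℕ) (h : 2 * r ≤ n) :
    ∑ l ∈ Finset.range (r + 1), ballot (n - 2 * l) l = n.choose r := by
  induction r with
  | zero => simp [ballot_zero]
  | succ r ih =>
    rw [Finset.sum_range_succ, ih (by omega), add_comm]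
    have := ballot_add_choose (n - 2 * (r + 1)) r
    rwa [show n - 2 * (r + 1) + 2 * (r + 1) = n by omega] at this

namespace IsTLSequence

variable {δ : k} {u : ℕ → B}

/-- If `x` satisfies, modulo `Y`, the relations of a half-diagram with defects at
`a, …, a + m - 1` followed by `l` arcs that join neighbours, then `A_a x` has dimension at most
`ballot m l` modulo `Y`. -/
theorem exists_spanning (hu : IsTLSequence δ u) (hδ : δ ≠ 0) (m l a : ℕ) (x : B)
    (Y : Submodule k B) (hY : ∀ i ≥ a, ∀ y ∈ Y, u i * y ∈ Y)
    (hx : ∀ i, a ≤ i → i + 1 < a + m → u i * x ∈ Y)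
    (hx' : ∀ j < l, u (a + m + 2 * j) * x - δ • x ∈ Y)
    (h0 : ∀ i, a + m + 2 * l ≤ i + 1 → u i = 0) :
    ∃ S : Finset B, S.card ≤ ballot m l ∧ orbit k u a x Y ≤ Submodule.span k (S : Set B) ⊔ Y := by
  classical
  match m, l with
  | m, 0 =>
    refine ⟨{x}, by rw [ballot_zero]; simp, orbit_le le_sup_right fun t ht => ?_⟩
    have hxs : x ∈ Submodule.span k (({x} : Finset B) : Set B) ⊔ Y :=
      Submodule.mem_sup_left (Submodule.subset_span (by simp))
    refine tailAlgebra_mul_mem (fun i hi y hy => ?_) ht hxs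
    obtain ⟨z, hz, y, hy', rfl⟩ := Submodule.mem_sup.1 hy
    rw [Finset.coe_singleton] at hz
    obtain ⟨c, rfl⟩ := Submodule.mem_span_singleton.1 hz
    rw [mul_add, mul_smul_comm]
    refine Submodule.mem_sup_right (add_mem (Y.smul_mem _ ?_) (hY i hi y hy'))
    by_cases h : i + 1 < a + m
    · exact hx i hi h
    · rw [h0 i (by omega), zero_mul]; exact zero_mem _
  | 0, l + 1 =>
    -- Without its first point, the half-diagram has one defect.
    obtain ⟨S, hS, h⟩ := hu.exists_spanning hδ 1 l (a + 1) x Y (fun i hi => hY i (by omega))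
      (fun i _ _ => by omega)
      (fun j hj => by
        have := hx' (j + 1) (by omega)
        rwa [show a + 0 + 2 * (j + 1) = a + 1 + 1 + 2 * j by ring] at this)
      (fun i hi => h0 i (by omega))
    refine ⟨S, by rw [ballot]; exact hS, (orbit_le (le_orbit _ _ _) fun t ht => ?_).trans h⟩
    exact hu.mul_mem_orbit_of_joined hδ hY (by simpa using hx' 0 (by omega)) ht
  | m + 1, l + 1 =>
    -- `S` spans the half-diagrams whose first point is a defect, and `S'` the remaining ones.
    obtain ⟨S, hS, h⟩ := hu.exists_spanning hδ m (l + 1) (a + 1) x Y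
      (fun i hi => hY i (by omega)) (fun i hi hi' => hx i (by omega) (by omega))
      (fun j hj => by
        have := hx' j hj
        rwa [show a + (m + 1) + 2 * j = a + 1 + m + 2 * j by ring] at this)
      (fun i hi => h0 i (by omega))
    have hYst : ∀ i ≥ a + 1, ∀ y ∈ orbit k u (a + 1) x Y, u i * y ∈ orbit k u (a + 1) x Y :=
      orbit_stable le_rfl fun i hi => hY i (by omega)
    have hY' : ∀ t ∈ tailAlgebra k u a, ∀ y ∈ Y, t * y ∈ Y := fun t ht y hy =>
      tailAlgebra_mul_mem hY ht hy
    have hx0 : u (a + m + 1) * x - δ • x ∈ Y := by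
      simpa [add_assoc] using hx' 0 (by omega)
    obtain ⟨S', hS', h'⟩ := hu.exists_spanning hδ (m + 2) l (a + 1) (run u a (m + 1) * x)
      (orbit k u (a + 1) x Y) hYst
      (fun i hi hi' => by
        obtain ⟨p, rfl⟩ : ∃ p, i = a + p + 1 := ⟨i - a - 1, by omega⟩
        by_cases hp : p + 1 < m + 1
        · -- The new arc is undone; either a cap is applied to two defects of `x`, or `A_{a+1} x`
          -- is reached.
          rw [← mul_assoc, hu.mul_run a hp, mul_assoc]
          rcases p with _ | p
          · simp only [run, one_mul]
            exact mul_mem_orbit _ _ (tailAlgebra_anti (by omega) (run_mem _ _))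
          · rw [run, mul_assoc]
            refine le_orbit _ _ _ (hY' _ (tailAlgebra_anti (by omega) (run_mem _ _)) _
              (hY' _ (run_mem _ _) _ (hx _ (by omega) (by omega))))
        · obtain rfl : p = m := by omega
          have hrx : run u a p * x ∈ orbit k u (a + 1) x Y := by
            rcases p with _ | p
            · simpa [run] using self_mem_orbit _ _ _
            · rw [run, mul_assoc]
              exact le_orbit _ _ _ (hY' _ (run_mem _ _) _ (hx _ (by omega) (by omega)))
          have : δ • (u (a + p + 1) * (run u a (p + 1) * x)) =
              run u a p * (u (a + p + 1) * x - δ • x) + δ • (run u a p * x) -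
              u (a + p + 1) * run u a (p + 1) * (u (a + p + 1) * x - δ • x) := by
            have h3 : u (a + p + 1) * run u a (p + 1) * (u (a + p + 1) * x) =
                run u a p * (u (a + p + 1) * x) := by
              rw [run, ← mul_assoc (u (a + p + 1)), ← (hu.commute_run le_rfl).eq]
              calc _ = run u a p * (u (a + p + 1) * u (a + p) * u (a + p + 1)) * x := by
                    noncomm_ring
                _ = _ := by rw [hu.adj_left, mul_assoc]
            rw [mul_sub, mul_sub, h3, mul_smul_comm, mul_smul_comm, mul_assoc]
            abel
          rw [← Submodule.smul_mem_iff _ hδ, this]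
          refine sub_mem (add_mem (le_orbit _ _ _ (hY' _ (run_mem _ _) _ hx0))
            (Submodule.smul_mem _ _ hrx)) (le_orbit _ _ _ (hY' _ ?_ _ hx0))
          exact mul_mem (mem_tailAlgebra (by omega)) (run_mem _ _))
      (fun j hj => by
        have := hx' (j + 1) (by omega)
        rw [show a + (m + 1) + 2 * (j + 1) = a + 1 + (m + 2) + 2 * j by ring] at this
        rw [← mul_assoc, ← (hu.commute_run (by omega)).eq, mul_assoc, ← mul_smul_comm, ← mul_sub]
        exact le_orbit _ _ _ (hY' _ (run_mem _ _) _ this))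
      (fun i hi => h0 i (by omega))
    refine ⟨S ∪ S', (Finset.card_union_le _ _).trans (by rw [ballot]; omega), ?_⟩
    have hle : orbit k u a x Y ≤
        orbit k u (a + 1) (run u a (m + 1) * x) (orbit k u (a + 1) x Y) := by
      refine orbit_le ((le_orbit _ _ _).trans (le_orbit _ _ _)) fun t ht => ?_
      exact hu.mul_mem_of_run hδ hY ((le_orbit _ _ _).trans (le_orbit _ _ _))
        (orbit_stable le_rfl hYst) (fun i hi hi' => hx i hi (by omega)) hx0
        (le_orbit _ _ _ (self_mem_orbit _ _ _)) (self_mem_orbit _ _ _) ht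
    refine hle.trans (h'.trans ?_)
    rw [Finset.coe_union, Submodule.span_union]
    refine sup_le (le_sup_right.trans le_sup_left) (h.trans (sup_le_sup_right le_sup_left _))
termination_by (l, m)

end IsTLSequence
end TLSequence

/-! ### The idempotents and standard modules of the Temperley–Lieb algebra -/

theorem higherIdeal_mul_mem {A ι : Type*} [Ring A] [LT ι] {e : ι → A} {i : ι} {x : A}
    (hx : x ∈ higherIdeal e i) (a : A) : x * a ∈ higherIdeal e i := by
  induction hx using Submodule.span_induction with
  | mem x h =>
    obtain ⟨j, hj, b, rfl⟩ := h
    exact Ideal.subset_span ⟨j, hj, b * a, by rw [mul_assoc]⟩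
  | zero => simp
  | add x y _ _ hx hy => rw [add_mul]; exact add_mem hx hy
  | smul b x _ hx => rw [smul_eq_mul, mul_assoc]; exact Ideal.mul_mem_left _ _ hx

namespace TL

universe u

variable {k : Type u} [Field k]

/-- The generators indexed by natural numbers, extended by zero. -/
def gen (q : k) (n i : ℕ) : TL q n := if h : i < n - 1 then U q ⟨i, h⟩ else 0

theorem gen_of_lt (q : k) {n i : ℕ} (h : i < n - 1) : gen q n i = U q ⟨i, h⟩ := dif_pos h

theorem gen_of_le (q : k) {n i : ℕ} (h : n - 1 ≤ i) : gen q n i = 0 := dif_neg (not_lt.2 h)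

theorem gen_sq (q : k) (n i : ℕ) : gen q n i * gen q n i = qTwo q • gen q n i := by
  rcases lt_or_ge i (n - 1) with h | h
  · rw [gen_of_lt q h, U_sq]
  · simp [gen_of_le q h]

theorem gen_adj (q : k) (n : ℕ) {i j : ℕ} (hj : j < n - 1) (h : i + 1 = j ∨ j + 1 = i) :
    gen q n i * gen q n j * gen q n i = gen q n i := by
  rcases lt_or_ge i (n - 1) with hi | hi
  · rw [gen_of_lt q hi, gen_of_lt q hj, U_adj]
    exact h
  · simp [gen_of_le q hi]

theorem gen_comm (q : k) (n : ℕ) {i j : ℕ} (h : ¬ (i + 1 = j ∨ j + 1 = i)) :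
    gen q n i * gen q n j = gen q n j * gen q n i := by
  rcases lt_or_ge i (n - 1) with hi | hi
  · rcases lt_or_ge j (n - 1) with hj | hj
    · rw [gen_of_lt q hi, gen_of_lt q hj, U_comm]
      exact h
    · simp [gen_of_le q hj]
  · simp [gen_of_le q hi]

theorem isTLSequence_gen (q : k) (n : ℕ) : IsTLSequence (qTwo q) (gen q n) where
  sq := gen_sq q n
  adj_right i := by
    rcases lt_or_ge (i + 1) (n - 1) with h | h
    · exact ⟨1, by rw [gen_adj q n h (by omega), one_smul]⟩
    · exact ⟨0, by simp [gen_of_le q h]⟩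
  adj_left i := by
    rcases lt_or_ge i (n - 1) with h | h
    · exact gen_adj q n h (by omega)
    · simp [gen_of_le q (show n - 1 ≤ i + 1 by omega)]
  comm i j h := gen_comm q n (by omega)
  eventually_zero := ⟨n - 1, fun i hi => gen_of_le q hi⟩

/-- The reversed sequence starts with the generator that defines `ε`. -/
theorem isTLSequence_gen_reverse (q : k) (n : ℕ) :
    IsTLSequence (qTwo q) (fun i => if i < n - 1 then gen q n (n - 2 - i) else 0) where
  sq i := by
    split_ifs
    · exact gen_sq q n _
    · simp
  adj_right i := by
    by_cases h : i + 1 < n - 1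
    · refine ⟨1, ?_⟩
      rw [if_pos h, if_pos (by omega), gen_adj q n (by omega) (by omega), one_smul]
    · exact ⟨0, by simp [h]⟩
  adj_left i := by
    by_cases h : i + 1 < n - 1
    · rw [if_pos h, if_pos (by omega), gen_adj q n (by omega) (by omega)]
    · simp [h]
  comm i j h := by
    split_ifs
    · exact gen_comm q n (by omega)
    all_goals simp
  eventually_zero := ⟨n - 1, fun i hi => if_neg (not_lt.2 hi)⟩

theorem adjoin_gen (q : k) (n : ℕ) {s : Set (TL q n)} (h : ∀ i < n - 1, gen q n i ∈ s)
    (a : TL q n) : a ∈ Algebra.adjoin k s := by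
  induction a using TL.induction with
  | halg c => exact Subalgebra.algebraMap_mem _ c
  | hU i =>
    rw [← gen_of_lt q i.2]
    exact Algebra.subset_adjoin (h i i.2)
  | hmul a b ha hb => exact mul_mem ha hb
  | hadd a b ha hb => exact add_mem ha hb

theorem mem_tailAlgebra_zero (q : k) (n : ℕ) (a : TL q n) : a ∈ tailAlgebra k (gen q n) 0 :=
  adjoin_gen q n (fun i _ => Set.mem_image_of_mem _ (Nat.zero_le i)) a

/-- `ε T_{n+2} ε = ε T_n`: the corner of the reversed sequence of generators at its first term. -/
theorem exists_eps_mul_mul_eps (q : k) (n : ℕ) (t : TL q (n + 2)) :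
    ∃ b : TL q n, eps q n * t * eps q n = eps q n * incl q n b := by
  have hu := isTLSequence_gen_reverse q (n + 2)
  set u := fun i => if i < n + 2 - 1 then gen q (n + 2) (n + 2 - 2 - i) else 0 with hu_def
  have h0 : eps q n = (qTwo q)⁻¹ • u 0 := by
    rw [eps, hu_def]
    simp only [show 0 < n + 2 - 1 by omega, if_true]
    rw [gen_of_lt q (by omega)]
    rfl
  have ht : t ∈ tailAlgebra k u 0 := adjoin_gen q (n + 2) (fun i hi => by
    refine ⟨n - i, Nat.zero_le _, ?_⟩
    simp only [hu_def, if_pos (show n - i < n + 2 - 1 by omega)]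
    congr 1
    omega) t
  obtain ⟨s, hs, h⟩ := hu.exists_corner 0 ht
  have hle : tailAlgebra k u 2 ≤ (incl q n).range := by
    refine Algebra.adjoin_le ?_
    rintro _ ⟨i, hi, rfl⟩
    have hi : 2 ≤ i := hi
    by_cases h : i < n + 2 - 1
    · refine ⟨U q ⟨n - i, by omega⟩, ?_⟩
      simp only [hu_def, if_pos h]
      rw [gen_of_lt q (by omega)]
      change incl q n _ = _
      rw [incl, lift_U]
      rfl
    · simp only [hu_def, if_neg h]
      exact zero_mem _
  obtain ⟨b, rfl⟩ := hle hs
  refine ⟨(qTwo q)⁻¹ • b, ?_⟩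
  rw [h0, smul_mul_assoc, smul_mul_assoc, mul_smul_comm, h, map_smul, smul_mul_assoc,
    mul_smul_comm]
  rfl

/-- The idempotents of the heredity chain, indexed by natural numbers. -/
def idemNat (q : k) (n : ℕ) : ℕ → TL q n
  | 0 => 1
  | l + 1 => idemNat q n l * ((qTwo q)⁻¹ • gen q n (n - 2 - 2 * l))

theorem idem_eq (q : k) (n : ℕ) (l : Fin (n / 2 + 1)) : idem q n l = idemNat q n l := by
  obtain ⟨l, hl⟩ := l
  have : ∀ l (h : 2 * l ≤ n), (List.ofFn fun i : Fin l =>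
      (qTwo q)⁻¹ • U q (n := n) ⟨n - 2 - 2 * i.val, by omega⟩).prod = idemNat q n l := by
    intro l
    induction l with
    | zero => intro _; simp [idemNat]
    | succ l ih =>
      intro h
      rw [List.ofFn_succ', List.concat_eq_append, List.prod_append, List.prod_singleton, idemNat,
        ← ih (by omega), gen_of_lt q (by omega)]
      rfl
  exact this l (by omega)

variable (q : k) (n : ℕ)

theorem gen_mul_idemNat_comm {l j : ℕ} (hl : 2 * l ≤ n) (hj : j + 2 * l + 2 ≤ n) :
    gen q n j * idemNat q n l = idemNat q n l * gen q n j := by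
  induction l with
  | zero => simp [idemNat]
  | succ l ih =>
    rw [idemNat, ← mul_assoc, ih (by omega) (by omega), mul_assoc, mul_assoc, mul_smul_comm,
      smul_mul_assoc, gen_comm q n (by omega)]

variable {q n}

theorem gen_mul_idemNat {l i : ℕ} (hl : 2 * l ≤ n) (hi : i < l) :
    gen q n (n - 2 - 2 * i) * idemNat q n l = qTwo q • idemNat q n l := by
  induction l with
  | zero => omega
  | succ l ih =>
    rcases Nat.lt_succ_iff_lt_or_eq.1 hi with h | rfl
    · rw [idemNat, ← mul_assoc, ih (by omega) h, smul_mul_assoc]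
    · rw [idemNat, ← mul_assoc, gen_mul_idemNat_comm q n (by omega) (by omega), mul_assoc,
        mul_smul_comm, gen_sq, mul_smul_comm, mul_smul_comm, mul_smul_comm, smul_comm]

theorem idemNat_mul_gen {l i : ℕ} (hl : 2 * l ≤ n) (hi : i < l) :
    idemNat q n l * gen q n (n - 2 - 2 * i) = qTwo q • idemNat q n l := by
  induction l with
  | zero => omega
  | succ l ih =>
    rcases Nat.lt_succ_iff_lt_or_eq.1 hi with h | rfl
    · rw [idemNat, mul_assoc, smul_mul_assoc, gen_comm q n (by omega), ← mul_smul_comm,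
        ← mul_assoc, ih (by omega) h, smul_mul_assoc]
    · rw [idemNat, mul_assoc, smul_mul_assoc, gen_sq, mul_smul_comm, mul_smul_comm, mul_smul_comm,
        smul_comm]

theorem idemNat_mul_idemNat (hq : qTwo q ≠ 0) {l j : ℕ} (hj : 2 * j ≤ n) (hl : l ≤ j) :
    idemNat q n l * idemNat q n j = idemNat q n j := by
  induction l with
  | zero => simp [idemNat]
  | succ l ih =>
    rw [idemNat, mul_assoc, smul_mul_assoc, gen_mul_idemNat hj (by omega), smul_smul,
      inv_mul_cancel₀ hq, one_smul, ih (by omega)]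

theorem idemNat_mul_idemNat' (hq : qTwo q ≠ 0) {l j : ℕ} (hj : 2 * j ≤ n) (hl : l ≤ j) :
    idemNat q n j * idemNat q n l = idemNat q n j := by
  induction l with
  | zero => simp [idemNat]
  | succ l ih =>
    rw [idemNat, ← mul_assoc, ih (by omega), mul_smul_comm, idemNat_mul_gen hj (by omega),
      smul_smul, inv_mul_cancel₀ hq, one_smul]

theorem idemNat_mem_higherIdeal (l : Fin (n / 2 + 1)) {j : ℕ} (hj : 2 * j ≤ n) (hl : l < j) :
    idemNat q n j ∈ higherIdeal (idem q n) l := by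
  refine Ideal.subset_span ⟨⟨j, by omega⟩, hl, 1, ?_⟩
  rw [idem_eq, mul_one]

/-- A cap on two of the first `n - 2l` points increases the number of arcs. -/
theorem gen_mul_idemNat_mem (hq : qTwo q ≠ 0) (l : Fin (n / 2 + 1)) {i : ℕ}
    (hi : i + 2 * l + 2 ≤ n) : gen q n i * idemNat q n l ∈ higherIdeal (idem q n) l := by
  obtain ⟨d, hd⟩ : ∃ d, i + d + 2 * l + 2 = n := ⟨n - 2 * l - 2 - i, by omega⟩
  induction d generalizing i with
  | zero =>
    have h := idemNat_mem_higherIdeal (q := q) l (j := l + 1) (by omega) (by omega)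
    rw [idemNat, mul_smul_comm, show n - 2 - 2 * l = i by omega,
      ← gen_mul_idemNat_comm q n (by omega) (by omega)] at h
    have := Submodule.smul_of_tower_mem _ (qTwo q) h
    rwa [smul_smul, mul_inv_cancel₀ hq, one_smul] at this
  | succ d ih =>
    have h := ih (i := i + 1) (by omega) (by omega)
    rw [← gen_adj q n (i := i) (j := i + 1) (by omega) (by omega), mul_assoc,
      gen_mul_idemNat_comm q n (by omega) (by omega), mul_assoc, ← mul_assoc (gen q n (i + 1))]
    exact Ideal.mul_mem_left _ _ (higherIdeal_mul_mem h _)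

variable (q n) in
/-- The anti-automorphism of `T_n(q)` that fixes the generators. -/
noncomputable def antiAut : (TL q n)ᵐᵒᵖ ≃ₐ[k] TL q n :=
  let f : TL q n →ₐ[k] (TL q n)ᵐᵒᵖ := lift q (fun i => MulOpposite.op (U q i))
    (fun i => by rw [← MulOpposite.op_mul, U_sq, MulOpposite.op_smul])
    (fun i j h => by
      rw [← MulOpposite.op_mul, ← MulOpposite.op_mul, ← mul_assoc, U_adj q i j h])
    (fun i j h => by rw [← MulOpposite.op_mul, ← MulOpposite.op_mul, U_comm q i j h])
  have hf : ∀ i, f (U q i) = MulOpposite.op (U q i) := fun i => lift_U q _ _ _ _ i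
  have hff : ∀ a, (f (f a).unop).unop = a := fun a => by
    induction a using TL.induction with
    | halg c => simp
    | hU i => simp [hf]
    | hmul a b ha hb => simp [ha, hb]
    | hadd a b ha hb => simp [ha, hb]
  AlgEquiv.ofAlgHom (AlgHom.opComm f) f
    (AlgHom.ext fun a => hff a)
    (AlgHom.ext fun a => MulOpposite.unop_injective (hff a.unop))

theorem antiAut_U (i : Fin (n - 1)) :
    antiAut q n (MulOpposite.op (U q i)) = U q i :=
  congrArg MulOpposite.unop (lift_U q _ _ _ _ i)

theorem antiAut_gen (i : ℕ) :
    antiAut q n (MulOpposite.op (gen q n i)) = gen q n i := by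
  rcases lt_or_ge i (n - 1) with h | h
  · rw [gen_of_lt q h, antiAut_U]
  · rw [gen_of_le q h, MulOpposite.op_zero, map_zero]

theorem antiAut_idem (l : Fin (n / 2 + 1)) :
    antiAut q n (MulOpposite.op (idem q n l)) = idem q n l := by
  rw [idem_eq]
  obtain ⟨l, hl⟩ := l
  simp only
  induction l with
  | zero => simp [idemNat]
  | succ l ih =>
    rw [idemNat, MulOpposite.op_mul, map_mul, ih (by omega), MulOpposite.op_smul, map_smul,
      antiAut_gen, smul_mul_assoc, gen_mul_idemNat_comm q n (by omega) (by omega),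
      mul_smul_comm]

/-- `Δ_n(n - 2l)` has at most the dimension of the space spanned by the half-diagrams with `l`
arcs. -/
theorem finrank_standard_le (hq : qTwo q ≠ 0) (l : Fin (n / 2 + 1)) :
    Module.Finite k (Standard (idem q n) l) ∧
      Module.finrank k (Standard (idem q n) l) ≤ ballot (n - 2 * l) l := by
  have hl : 2 * l.val ≤ n := by omega
  have hY : ∀ i, ∀ y ∈ (higherIdeal (idem q n) l).restrictScalars k,
      gen q n i * y ∈ (higherIdeal (idem q n) l).restrictScalars k := fun i y hy =>
    Ideal.mul_mem_left _ _ hy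
  obtain ⟨S, hS, h⟩ := (isTLSequence_gen q n).exists_spanning hq (n - 2 * l) l 0
    (idemNat q n l) ((higherIdeal (idem q n) l).restrictScalars k) (fun i _ => hY i)
    (fun i _ hi => gen_mul_idemNat_mem hq l (by omega))
    (fun j hj => by
      have := gen_mul_idemNat (q := q) hl (i := l - 1 - j) (by omega)
      rw [show n - 2 - 2 * (l - 1 - j) = 0 + (n - 2 * l) + 2 * j by omega] at this
      rw [this, sub_self]
      exact zero_mem _)
    (fun i hi => gen_of_le q (by omega))
  let f : ↥(Ideal.span {idem q n l}) →ₗ[TL q n] TL q n ⧸ higherIdeal (idem q n) l :=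
    (higherIdeal (idem q n) l).mkQ ∘ₗ (Ideal.span {idem q n l}).subtype
  have hf : LinearMap.ker f = Submodule.submoduleOf (higherIdeal (idem q n) l)
      (Ideal.span {idem q n l}) := by
    rw [LinearMap.ker_comp, Submodule.ker_mkQ]
    rfl
  let g : Standard (idem q n) l →ₗ[TL q n] TL q n ⧸ higherIdeal (idem q n) l :=
    Submodule.liftQ _ f hf.ge
  have hg : Function.Injective g := by
    rw [← LinearMap.ker_eq_bot]
    exact Submodule.ker_liftQ_eq_bot _ _ _ hf.le
  let W : Submodule k (TL q n ⧸ higherIdeal (idem q n) l) :=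
    (Submodule.span k (S : Set (TL q n))).map ((higherIdeal (idem q n) l).mkQ.restrictScalars k)
  have hW : ∀ x, g x ∈ W := by
    intro x
    obtain ⟨⟨x, hx⟩, rfl⟩ := Submodule.mkQ_surjective _ x
    obtain ⟨a, rfl⟩ := Ideal.mem_span_singleton'.1 hx
    have h1 := h (IsTLSequence.mul_mem_orbit _ _ (mem_tailAlgebra_zero q n a))
    obtain ⟨s, hs, y, hy, hsy⟩ := Submodule.mem_sup.1 h1
    refine ⟨s, hs, ?_⟩
    change Submodule.Quotient.mk s = Submodule.Quotient.mk (a * idem q n l)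
    rw [idem_eq, ← hsy, Submodule.Quotient.eq]
    simpa using hy
  let g' : Standard (idem q n) l →ₗ[k] W := (g.restrictScalars k).codRestrict W hW
  have hg' : Function.Injective g' := fun x y hxy => hg (congrArg Subtype.val hxy)
  have hWf : Module.Finite k W := by
    have : Module.Finite k (Submodule.span k (S : Set (TL q n))) :=
      Module.Finite.span_of_finite k S.finite_toSet
    exact Module.Finite.map _ _
  refine ⟨Module.Finite.of_injective g' hg', ?_⟩
  have : Module.Finite k (Submodule.span k (S : Set (TL q n))) :=
    Module.Finite.span_of_finite k S.finite_toSet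
  calc _ ≤ Module.finrank k W := LinearMap.finrank_le_finrank_of_injective hg'
    _ ≤ Module.finrank k (Submodule.span k (S : Set (TL q n))) := Submodule.finrank_map_le _ _
    _ ≤ S.card := finrank_span_finset_le_card S
    _ ≤ _ := hS

end TL

/-! ### A criterion for standard filtrations -/

/-- Additivity of `k`-dimension for a pair of submodules over a `k`-algebra. -/
theorem Submodule.finrank_submoduleOf_quotient_add {k A M : Type*} [Field k] [Ring A] [Algebra k A]
    [AddCommGroup M] [Module k M] [Module A M] [IsScalarTower k A M] [Module.Finite k M]
    {N N' : Submodule A M} (h : N ≤ N') :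
    Module.finrank k (N' ⧸ N.submoduleOf N') + Module.finrank k N = Module.finrank k N' := by
  have : Module.Finite k N' :=
    Module.Finite.of_injective (N'.subtype.restrictScalars k) Subtype.val_injective
  let f : N' →ₗ[k] N' ⧸ N.submoduleOf N' := (Submodule.mkQ (N.submoduleOf N')).restrictScalars k
  have hf : Function.Surjective f := (N.submoduleOf N').mkQ_surjective
  have h1 := LinearMap.finrank_range_add_finrank_ker f
  rw [LinearMap.range_eq_top.2 hf, finrank_top] at h1
  have hker : LinearMap.ker f = (N.submoduleOf N').restrictScalars k := by
    ext x
    exact Submodule.Quotient.mk_eq_zero _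
  have h2 : Module.finrank k (LinearMap.ker f) = Module.finrank k N := by
    rw [hker]
    exact ((Submodule.submoduleOfEquivOfLe h).restrictScalars k).finrank_eq
  rw [← h1, h2]

namespace TL

universe u w

variable {k : Type u} [Field k] {q : k} {n : ℕ} {M : Type w} [AddCommGroup M]
  [Module (TL q n) M]

variable (q n M) in
/-- The submodule `∑_{j ≥ l} T_n e_j M` of `M`. -/
def traceSubmodule (l : ℕ) : Submodule (TL q n) M :=
  Submodule.span (TL q n) {y | ∃ j : Fin (n / 2 + 1), l ≤ j ∧ ∃ x : M, y = idem q n j • x}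

theorem idem_smul_mem_traceSubmodule {l : ℕ} {j : Fin (n / 2 + 1)} (h : l ≤ j) (x : M) :
    idem q n j • x ∈ traceSubmodule q n M l :=
  Submodule.subset_span ⟨j, h, x, rfl⟩

theorem traceSubmodule_anti {l l' : ℕ} (h : l ≤ l') :
    traceSubmodule q n M l' ≤ traceSubmodule q n M l := by
  refine Submodule.span_mono ?_
  rintro _ ⟨j, hj, x, rfl⟩
  exact ⟨j, h.trans hj, x, rfl⟩

theorem smul_mem_traceSubmodule {l : Fin (n / 2 + 1)} {a : TL q n}
    (ha : a ∈ higherIdeal (idem q n) l) (x : M) : a • x ∈ traceSubmodule q n M (l + 1) := by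
  induction ha using Submodule.span_induction with
  | mem a h =>
    obtain ⟨j, hj, b, rfl⟩ := h
    rw [mul_smul]
    exact idem_smul_mem_traceSubmodule hj _
  | zero => rw [zero_smul]; exact zero_mem _
  | add a b _ _ ha hb => rw [add_smul]; exact add_mem ha hb
  | smul b a _ ha => rw [smul_assoc]; exact Submodule.smul_mem _ _ ha

variable [Module k M] [IsScalarTower k (TL q n) M]

/-- If `e_l M` is at most one-dimensional modulo `∑_{j > l} T_n e_j M`, then the `l`-th layer of the
trace filtration is a quotient of `Δ(l)`. -/
theorem exists_surjective_layer (hq : qTwo q ≠ 0) (l : Fin (n / 2 + 1)) (w : M)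
    (h : ∀ x : M, ∃ c : k, idem q n l • x - c • w ∈ traceSubmodule q n M (l + 1)) :
    ∃ f : Standard (idem q n) l →ₗ[TL q n] (traceSubmodule q n M l ⧸
      (traceSubmodule q n M (l + 1)).submoduleOf (traceSubmodule q n M l)),
      Function.Surjective f := by
  have hmem : ∀ t : ↥(Ideal.span {idem q n l}), t.1 • w ∈ traceSubmodule q n M l := by
    rintro ⟨t, ht⟩
    obtain ⟨a, rfl⟩ := Ideal.mem_span_singleton'.1 ht
    rw [mul_smul]
    exact Submodule.smul_mem _ _ (idem_smul_mem_traceSubmodule le_rfl w)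
  let f₀ : ↥(Ideal.span {idem q n l}) →ₗ[TL q n] traceSubmodule q n M l :=
    (LinearMap.toSpanSingleton (TL q n) M w ∘ₗ (Ideal.span {idem q n l}).subtype).codRestrict _ hmem
  let f : Standard (idem q n) l →ₗ[TL q n] _ :=
    Submodule.liftQ _ (Submodule.mkQ ((traceSubmodule q n M (l + 1)).submoduleOf
      (traceSubmodule q n M l)) ∘ₗ f₀) (by
        intro t ht
        exact (Submodule.Quotient.mk_eq_zero _).2 (smul_mem_traceSubmodule (a := t.1) ht w))
  refine ⟨f, ?_⟩
  have hidem : idem q n l * idem q n l = idem q n l := by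
    rw [idem_eq, idemNat_mul_idemNat hq (by omega) le_rfl]
  rintro z
  obtain ⟨⟨z, hz⟩, rfl⟩ := Submodule.mkQ_surjective _ z
  -- It suffices to find a preimage up to an element of the smaller trace submodule.
  suffices ∃ t : ↥(Ideal.span {idem q n l}), z - t.1 • w ∈ traceSubmodule q n M (l + 1) by
    obtain ⟨t, ht⟩ := this
    refine ⟨Submodule.Quotient.mk t, Eq.symm ?_⟩
    exact (Submodule.Quotient.eq _).2 ht
  induction hz using Submodule.span_induction with
  | mem z hz =>
    obtain ⟨j, hj, x, rfl⟩ := hz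
    rcases eq_or_lt_of_le hj with hj | hj
    · obtain rfl : l = j := Fin.ext hj
      obtain ⟨c, hc⟩ := h x
      refine ⟨c • ⟨idem q n l, Ideal.mem_span_singleton_self _⟩, ?_⟩
      have := Submodule.smul_mem _ (idem q n l) hc
      rw [smul_sub, smul_smul, hidem, ← smul_comm c] at this
      simpa using this
    · exact ⟨0, by simpa using idem_smul_mem_traceSubmodule hj x⟩
  | zero => exact ⟨0, by simp⟩
  | add x y _ _ hx hy =>
    obtain ⟨s, hs⟩ := hx
    obtain ⟨t, ht⟩ := hy
    refine ⟨s + t, ?_⟩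
    have := add_mem hs ht
    rwa [sub_add_sub_comm, ← add_smul] at this
  | smul a x _ hx =>
    obtain ⟨s, hs⟩ := hx
    refine ⟨a • s, ?_⟩
    have := Submodule.smul_mem _ a hs
    rwa [smul_sub, ← smul_assoc] at this

/-- The dimension of `M` forces all the surjections of `exists_surjective_layer` to be
isomorphisms. -/
theorem hasFiltration_standard_of_finrank (hq : qTwo q ≠ 0) [Module.Finite k M] {r : ℕ}
    (hr : 2 * r ≤ n) (hdim : Module.finrank k M = n.choose r)
    (hle : ∀ l : Fin (n / 2 + 1), l ≤ r →
      ∃ w : M, ∀ x : M, ∃ c : k, idem q n l • x - c • w ∈ traceSubmodule q n M (l + 1))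
    (hlt : ∀ l : Fin (n / 2 + 1), r < l → ∀ x : M, idem q n l • x = 0) :
    HasFiltration (TL q n) (fun l => Standard (idem q n) l) M := by
  have htop : traceSubmodule q n M 0 = ⊤ := by
    rw [eq_top_iff]
    intro x _
    have := idem_smul_mem_traceSubmodule (q := q) (Nat.zero_le (0 : Fin (n / 2 + 1))) x
    rwa [idem_eq, Fin.val_zero, idemNat, one_smul] at this
  have hbot : traceSubmodule q n M (r + 1) = ⊥ := by
    rw [eq_bot_iff]
    refine Submodule.span_le.2 ?_
    rintro _ ⟨j, hj, x, rfl⟩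
    exact hlt j hj x
  have hsurj : ∀ l : Fin (n / 2 + 1), l ≤ r →
      ∃ f : Standard (idem q n) l →ₗ[TL q n] (traceSubmodule q n M l ⧸
        (traceSubmodule q n M (l + 1)).submoduleOf (traceSubmodule q n M l)),
        Function.Surjective f := by
    intro l hl
    obtain ⟨w, hw⟩ := hle l hl
    exact exists_surjective_layer hq l w hw
  have hQle : ∀ l ∈ Finset.range (r + 1), Module.finrank k (traceSubmodule q n M l ⧸
      (traceSubmodule q n M (l + 1)).submoduleOf (traceSubmodule q n M l)) ≤
      ballot (n - 2 * l) l := by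
    intro l hl
    have hl := Finset.mem_range.1 hl
    obtain ⟨f, hf⟩ := hsurj ⟨l, by omega⟩ (by simp only; omega)
    obtain ⟨h1, h2⟩ := finrank_standard_le (n := n) hq ⟨l, by omega⟩
    exact (LinearMap.finrank_le_finrank_of_surjective (f := f.restrictScalars k) hf).trans h2
  have hsum : ∑ l ∈ Finset.range (r + 1), Module.finrank k (traceSubmodule q n M l ⧸
      (traceSubmodule q n M (l + 1)).submoduleOf (traceSubmodule q n M l)) =
      ∑ l ∈ Finset.range (r + 1), ballot (n - 2 * l) l := by
    rw [sum_ballot n r hr, ← hdim]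
    have : ∀ m, ∑ l ∈ Finset.range m, Module.finrank k (traceSubmodule q n M l ⧸
        (traceSubmodule q n M (l + 1)).submoduleOf (traceSubmodule q n M l)) +
        Module.finrank k (traceSubmodule q n M m) = Module.finrank k M := by
      intro m
      induction m with
      | zero =>
        rw [htop, Finset.range_zero, Finset.sum_empty, zero_add]
        exact (Submodule.topEquiv.restrictScalars k).finrank_eq
      | succ m ih => rw [Finset.sum_range_succ, add_assoc,
        Submodule.finrank_submoduleOf_quotient_add (traceSubmodule_anti (Nat.le_succ m)), ih]
    have h := this (r + 1)
    rw [hbot] at h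
    have h0 : Module.finrank k (⊥ : Submodule (TL q n) M) = 0 :=
      Module.finrank_zero_of_subsingleton
    omega
  have heq := (Finset.sum_eq_sum_iff_of_le hQle).1 hsum
  rw [hasFiltration_iff_isFiltered_top, ← htop]
  suffices ∀ d l, l + d = r + 1 →
      IsFiltered (fun l => Standard (idem q n) l) (traceSubmodule q n M l) from
    this (r + 1) 0 (by omega)
  intro d
  induction d with
  | zero =>
    intro l hl
    rw [show l = r + 1 by omega, hbot]
    exact .bot
  | succ d ih =>
    intro l hl
    have hl' : l < n / 2 + 1 := by omega
    refine .step ⟨l, hl'⟩ (ih (l + 1) (by omega)) ?_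
    rw [isLayer_iff]
    refine ⟨traceSubmodule_anti (Nat.le_succ l), ?_⟩
    obtain ⟨f, hf⟩ := hsurj ⟨l, hl'⟩ (by simp only; omega)
    obtain ⟨h1, h2⟩ := finrank_standard_le (n := n) hq ⟨l, hl'⟩
    have h3 := heq l (Finset.mem_range.2 (by omega))
    have hinj : Function.Injective f := by
      have h4 := LinearMap.finrank_range_add_finrank_ker (f.restrictScalars k)
      rw [LinearMap.range_eq_top.2 (show Function.Surjective (f.restrictScalars k) from hf),
        finrank_top] at h4
      have h5 : Module.finrank k (LinearMap.ker (f.restrictScalars k)) = 0 := by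
        simp only at h2 h4
        omega
      have h6 := Submodule.finrank_eq_zero.1 h5
      exact LinearMap.ker_eq_bot (f := f.restrictScalars k) |>.1 h6
    exact ⟨(LinearEquiv.ofBijective f ⟨hinj, hf⟩).symm⟩

/-! ### Costandard filtrations from symmetric matrices -/

/-- If the generators act by symmetric matrices, a standard filtration yields a costandard
filtration. -/
theorem hasFiltration_costandard_of_symmetric {ι : Type*} [Fintype ι] [DecidableEq ι]
    (b : Module.Basis ι k M)
    (hb : ∀ (i : Fin (n - 1)) v w, b.repr (U q i • b v) w = b.repr (U q i • b w) v)
    (h : HasFiltration (TL q n) (fun l => Standard (idem q n) l) M) :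
    HasFiltration (TL q n) (fun l => Costandard k (idem q n) l) M := by
  have : Module.Finite k M := Module.Finite.of_basis b
  refine h.costandard_of_standard (τ := antiAut q n) antiAut_idem (B := b.toDualEquiv) ?_
  intro a
  induction a using induction with
  | halg c =>
    intro x y
    rw [show MulOpposite.op (algebraMap k (TL q n) c) = algebraMap k _ c from rfl,
      AlgEquiv.commutes, algebraMap_smul, algebraMap_smul, map_smul, map_smul]
    rfl
  | hU i =>
    intro x y
    rw [antiAut_U]
    let f : M →ₗ[k] M := Algebra.lsmul k k M (U q i)
    have : b.toDual ∘ₗ f = f.dualMap ∘ₗ b.toDual := by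
      refine b.ext fun v => b.ext fun w => ?_
      change b.toDual (U q i • b v) (b w) = b.toDual (b v) (U q i • b w)
      rw [b.toDual_apply_left, b.toDual_apply_right, hb]
    exact LinearMap.congr_fun (LinearMap.congr_fun this x) y
  | hmul a b ha hb =>
    intro x y
    rw [mul_smul, ha, hb, MulOpposite.op_mul, map_mul, mul_smul]
  | hadd a b ha hb =>
    intro x y
    rw [add_smul, map_add, LinearMap.add_apply, ha, hb, MulOpposite.op_add, map_add, add_smul,
      map_add]

end TL

/-! ### Permutation modules -/

section PermModule

universe u

variable {k : Type u} [Field k] (q : k) [NeZero q]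

theorem mem_permModule_iff {s : ℤ} {n : ℕ} {x : TensorSpace q n} :
    x ∈ permModule q s n ↔ ∀ w, (TensorSpace.wordBasis q n).repr x w ≠ 0 → excess w = s := by
  change x ∈ Submodule.span k _ ↔ _
  rw [Module.Basis.mem_span_image]
  constructor
  · intro h w hw
    exact h (Finsupp.mem_support_iff.2 hw)
  · intro h w hw
    exact h w (Finsupp.mem_support_iff.1 hw)

theorem wordBasis_mem_permModule {n : ℕ} (w : Fin n → Fin 2) :
    TensorSpace.wordBasis q n w ∈ permModule q (excess w) n :=
  Submodule.subset_span (Set.mem_image_of_mem _ rfl)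

/-- The basis of `M(s, n)` that consists of words. -/
noncomputable def permBasis (s : ℤ) (n : ℕ) :
    Module.Basis {w : Fin n → Fin 2 // excess w = s} k (permModule q s n) :=
  Module.Basis.mk
    (v := fun w => ⟨TensorSpace.wordBasis q n w.1, Submodule.subset_span ⟨w.1, w.2, rfl⟩⟩)
    (by
      refine LinearIndependent.of_comp ((permModule q s n).subtype.restrictScalars k) ?_
      exact (TensorSpace.wordBasis q n).linearIndependent.comp _ Subtype.val_injective)
    (by
      rintro ⟨x, hx⟩ -
      have hx' : x ∈ Submodule.span k (TensorSpace.wordBasis q n '' {w | excess w = s}) := hx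
      induction hx' using Submodule.span_induction with
      | mem x h =>
        obtain ⟨w, hw, rfl⟩ := h
        exact Submodule.subset_span ⟨⟨w, hw⟩, rfl⟩
      | zero => exact zero_mem _
      | add x y h1 h2 ih1 ih2 => exact add_mem (ih1 h1) (ih2 h2)
      | smul c x h ih => exact Submodule.smul_mem _ c (ih h))

theorem coe_permBasis {s : ℤ} {n : ℕ} (w : {w : Fin n → Fin 2 // excess w = s}) :
    (permBasis q s n w : TensorSpace q n) = TensorSpace.wordBasis q n w.1 := by
  rw [permBasis, Module.Basis.mk_apply]

theorem permBasis_repr {s : ℤ} {n : ℕ} (x : permModule q s n)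
    (w : {w : Fin n → Fin 2 // excess w = s}) :
    (permBasis q s n).repr x w = (TensorSpace.wordBasis q n).repr x.1 w.1 := by
  let f : permModule q s n →ₗ[k] k := (permBasis q s n).coord w
  let g : permModule q s n →ₗ[k] k :=
    (TensorSpace.wordBasis q n).coord w.1 ∘ₗ (permModule q s n).subtype.restrictScalars k
  have : f = g := by
    refine (permBasis q s n).ext fun w' => ?_
    change (permBasis q s n).repr (permBasis q s n w') w =
      (TensorSpace.wordBasis q n).repr (permBasis q s n w').1 w.1
    rw [coe_permBasis, Module.Basis.repr_self, Module.Basis.repr_self, Finsupp.single_apply,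
      Finsupp.single_apply]
    simp only [Subtype.ext_iff]
  exact LinearMap.congr_fun this x

/-- The word obtained by exchanging the letters in positions `a` and `b`. -/
def swapWord {s : ℤ} {n : ℕ} (w : {w : Fin n → Fin 2 // excess w = s}) (a b : Fin n) :
    {w : Fin n → Fin 2 // excess w = s} :=
  ⟨w.1 ∘ Equiv.swap a b, (excess_comp w.1 _).trans w.2⟩

theorem swapWord_left {s : ℤ} {n : ℕ} (w : {w : Fin n → Fin 2 // excess w = s}) (a b : Fin n) :
    (swapWord w a b).1 a = w.1 b := congrArg w.1 (Equiv.swap_apply_left a b)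

theorem swapWord_right {s : ℤ} {n : ℕ} (w : {w : Fin n → Fin 2 // excess w = s}) (a b : Fin n) :
    (swapWord w a b).1 b = w.1 a := congrArg w.1 (Equiv.swap_apply_right a b)

theorem swapWord_of_ne {s : ℤ} {n : ℕ} (w : {w : Fin n → Fin 2 // excess w = s}) {a b x : Fin n}
    (ha : x ≠ a) (hb : x ≠ b) : (swapWord w a b).1 x = w.1 x :=
  congrArg w.1 (Equiv.swap_apply_of_ne_of_ne ha hb)

theorem swapWord_comm {s : ℤ} {n : ℕ} (w : {w : Fin n → Fin 2 // excess w = s}) (a b : Fin n) :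
    swapWord w a b = swapWord w b a := by
  simp only [swapWord, Equiv.swap_comm]

theorem gen_smul_wordBasis {n : ℕ} {a b : Fin n} (h : a.val + 1 = b.val) (w : Fin n → Fin 2) :
    TL.gen q n a • TensorSpace.wordBasis q n w = if w a = w b then 0
      else (if w a = 0 then q else q⁻¹) • TensorSpace.wordBasis q n w +
        TensorSpace.wordBasis q n (w ∘ Equiv.swap a b) := by
  rw [TL.gen_of_lt q (by omega), TensorSpace.U_smul, TensorSpace.opU]
  have hb : (⟨a.val + 1, by omega⟩ : Fin n) = b := Fin.ext h
  rw [hb]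
  exact TensorSpace.pairOp_basis q a b w

theorem gen_smul_permBasis {s : ℤ} {n : ℕ} {a b : Fin n} (h : a.val + 1 = b.val)
    (w : {w : Fin n → Fin 2 // excess w = s}) :
    TL.gen q n a • permBasis q s n w = if w.1 a = w.1 b then 0
      else (if w.1 a = 0 then q else q⁻¹) • permBasis q s n w +
        permBasis q s n (swapWord w a b) := by
  apply Subtype.ext
  rw [Submodule.coe_smul, coe_permBasis, gen_smul_wordBasis q h]
  split_ifs
  · rfl
  all_goals
    rw [Submodule.coe_add, coe_permBasis, Submodule.coe_smul_of_tower, coe_permBasis]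
    rfl

/-! ### Words modulo the trace of the smaller ideals -/

theorem card_filter_eq_of_excess {n : ℕ} {w w' : Fin n → Fin 2} (h : excess w = excess w')
    (c : Fin 2) : (Finset.univ.filter fun i => w i = c).card =
      (Finset.univ.filter fun i => w' i = c).card := by
  have key : ∀ w : Fin n → Fin 2, (Finset.univ.filter fun i => w i = 0).card +
      (Finset.univ.filter fun i => w i = 1).card = n := by
    intro w
    have := Finset.card_filter_add_card_filter_not (s := (Finset.univ : Finset (Fin n)))
      (fun i => w i = 0)
    rw [Finset.card_univ, Fintype.card_fin] at this
    refine Eq.trans ?_ this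
    congr 2
    ext i
    simp only [Finset.mem_filter, Finset.mem_univ, true_and]
    omega
  have h1 := key w
  have h2 := key w'
  simp only [excess] at h
  fin_cases c <;> simp only [Fin.zero_eta, Fin.mk_one] <;> omega

/-- In each of the last `l` pairs of neighbouring positions, the word `w` has two different
letters. -/
def IsSplit {n : ℕ} (l : ℕ) (w : Fin n → Fin 2) : Prop :=
  ∀ a b : Fin n, a.val + 1 = b.val → ∀ j < l, a.val = n - 2 - 2 * j → w a ≠ w b

theorem IsSplit.le_card {n l : ℕ} {w : Fin n → Fin 2} (h : IsSplit l w) (hl : 2 * l ≤ n)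
    (c : Fin 2) : l ≤ (Finset.univ.filter fun i => w i = c).card := by
  have : ∀ j : Fin l, ∃ i : Fin n, w i = c ∧ (n - 1 - i.val) / 2 = j.val := by
    intro j
    have h1 := h ⟨n - 2 - 2 * j, by omega⟩ ⟨n - 2 - 2 * j + 1, by omega⟩ rfl j j.2 rfl
    by_cases h2 : w ⟨n - 2 - 2 * j, by omega⟩ = c
    · exact ⟨_, h2, by simp only; omega⟩
    · exact ⟨⟨n - 2 - 2 * j + 1, by omega⟩, by omega, by simp only; omega⟩
  choose f hf hf' using this
  calc l = (Finset.univ : Finset (Fin l)).card := by simp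
    _ ≤ _ := Finset.card_le_card_of_injOn f (fun j _ => by simpa using hf j) (fun i _ j _ hij =>
      Fin.ext (by rw [← hf' i, ← hf' j, hij]))

variable {q} {n : ℕ} {s : ℤ}

/-- `e_l w'` is a multiple of `e_l w` modulo `∑_{j > l} T_n e_j M(s, n)`. -/
def IsMultiple (q : k) [NeZero q] (l : Fin (n / 2 + 1))
    (w w' : {w : Fin n → Fin 2 // excess w = s}) : Prop :=
  ∃ c : k, TL.idem q n l • permBasis q s n w' - c • (TL.idem q n l • permBasis q s n w) ∈
    TL.traceSubmodule q n (permModule q s n) (l + 1)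

theorem IsMultiple.refl (l : Fin (n / 2 + 1)) (w : {w : Fin n → Fin 2 // excess w = s}) :
    IsMultiple q l w w := ⟨1, by simp⟩

theorem IsMultiple.trans {l : Fin (n / 2 + 1)} {w w' w'' : {w : Fin n → Fin 2 // excess w = s}}
    (h : IsMultiple q l w w') (h' : IsMultiple q l w' w'') : IsMultiple q l w w'' := by
  obtain ⟨c, hc⟩ := h
  obtain ⟨c', hc'⟩ := h'
  refine ⟨c' * c, ?_⟩
  have := add_mem hc' (Submodule.smul_of_tower_mem _ c' hc)
  rwa [smul_sub, sub_add_sub_cancel, smul_smul] at this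

theorem swapWord_of_eq {w : {w : Fin n → Fin 2 // excess w = s}} {a b : Fin n}
    (h : w.1 a = w.1 b) : swapWord w a b = w := by
  apply Subtype.ext
  funext x
  change w.1 (Equiv.swap a b x) = w.1 x
  rw [Equiv.swap_apply_def]
  split_ifs with h1 h2
  · rw [h1, h]
  · rw [h2, h]
  · rfl

theorem isMultiple_swapWord_succ (hq : qTwo q ≠ 0) (l : Fin (n / 2 + 1)) {a b : Fin n}
    (hab : a.val + 1 = b.val) (hb : b.val + 2 * l < n)
    (w : {w : Fin n → Fin 2 // excess w = s}) : IsMultiple q l w (swapWord w a b) := by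
  by_cases hw : w.1 a = w.1 b
  · rw [swapWord_of_eq hw]
    exact .refl l w
  · have h1 := TL.smul_mem_traceSubmodule (TL.gen_mul_idemNat_mem hq l (i := a) (by omega))
      (permBasis q s n w)
    rw [TL.gen_mul_idemNat_comm q n (by omega) (by omega), mul_smul, gen_smul_permBasis q hab,
      if_neg hw, smul_add, ← TL.idem_eq] at h1
    refine ⟨-(if w.1 a = 0 then q else q⁻¹), ?_⟩
    rwa [neg_smul, sub_neg_eq_add, smul_comm _ (TL.idem q n l),
      add_comm (TL.idem q n l • permBasis q s n (swapWord w a b))]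

theorem isMultiple_swapWord (hq : qTwo q ≠ 0) (l : Fin (n / 2 + 1)) {a b : Fin n}
    (hab : a < b) (hb : b.val + 2 * l < n)
    (w : {w : Fin n → Fin 2 // excess w = s}) : IsMultiple q l w (swapWord w a b) := by
  obtain ⟨d, hd⟩ : ∃ d, a.val + d + 1 = b.val := ⟨b.val - a.val - 1, by omega⟩
  induction d generalizing a w with
  | zero => exact isMultiple_swapWord_succ hq l hd hb w
  | succ d ih =>
    let c : Fin n := ⟨a.val + 1, by omega⟩
    have hac : a ≠ c := Fin.ne_of_val_ne (by simp [c])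
    have hab' : a ≠ b := hab.ne
    have hcb : c < b := Fin.lt_def.2 (by simp only [c]; omega)
    have h1 := isMultiple_swapWord_succ hq l (a := a) (b := c) rfl (by simp only [c]; omega) w
    have h2 := ih hcb (swapWord w a c) (by simp only [c]; omega)
    have h3 := isMultiple_swapWord_succ hq l (a := a) (b := c) rfl (by simp only [c]; omega)
      (swapWord (swapWord w a c) c b)
    convert (h1.trans h2).trans h3 using 1
    apply Subtype.ext
    funext x
    change w.1 (Equiv.swap a b x) =
      w.1 (Equiv.swap a c (Equiv.swap c b (Equiv.swap a c x)))
    rw [← Equiv.Perm.mul_apply, ← Equiv.Perm.mul_apply, Equiv.swap_comm a c,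
      Equiv.swap_comm c b, Equiv.swap_mul_swap_mul_swap hcb.ne' hab'.symm]

theorem isMultiple_swapWord_pair (l : Fin (n / 2 + 1)) {a b : Fin n} (hab : a.val + 1 = b.val)
    {j : ℕ} (hj : j < l) (ha : a.val = n - 2 - 2 * j)
    (w : {w : Fin n → Fin 2 // excess w = s}) : IsMultiple q l w (swapWord w a b) := by
  by_cases hw : w.1 a = w.1 b
  · rw [swapWord_of_eq hw]
    exact .refl l w
  · have h1 : (TL.idem q n l * TL.gen q n a) • permBasis q s n w =
        (qTwo q • TL.idem q n l) • permBasis q s n w := by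
      rw [TL.idem_eq, ha, TL.idemNat_mul_gen (by omega) hj]
    rw [mul_smul, gen_smul_permBasis q hab, if_neg hw, smul_add, smul_assoc, smul_comm] at h1
    refine ⟨qTwo q - (if w.1 a = 0 then q else q⁻¹), ?_⟩
    rw [sub_smul, ← h1, add_sub_cancel_left, sub_self]
    exact zero_mem _

theorem idem_smul_eq_zero_of_not_isSplit (hq : qTwo q ≠ 0) (l : Fin (n / 2 + 1))
    {w : {w : Fin n → Fin 2 // excess w = s}} (hw : ¬ IsSplit l w.1) :
    TL.idem q n l • permBasis q s n w = 0 := by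
  simp only [IsSplit, not_forall, not_not] at hw
  obtain ⟨a, b, hab, j, hj, ha, h⟩ := hw
  have h1 : (TL.idem q n l * TL.gen q n a) • permBasis q s n w =
      (qTwo q • TL.idem q n l) • permBasis q s n w := by
    rw [TL.idem_eq, ha, TL.idemNat_mul_gen (by omega) hj]
  rw [mul_smul, gen_smul_permBasis q hab, if_pos h, smul_zero, smul_assoc] at h1
  exact (smul_eq_zero.1 h1.symm).resolve_left hq

/-- Two words with different letters in the last `l` pairs are related by exchanges within the pairs
and exchanges of the remaining letters. -/
theorem IsSplit.isMultiple (hq : qTwo q ≠ 0) (l : Fin (n / 2 + 1))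
    {w w' : {w : Fin n → Fin 2 // excess w = s}} (hw : IsSplit l w.1) (hw' : IsSplit l w'.1) :
    IsMultiple q l w w' := by
  obtain ⟨d, hd⟩ : ∃ d, (Finset.univ.filter fun i => w.1 i ≠ w'.1 i).card = d := ⟨_, rfl⟩
  induction d using Nat.strong_induction_on generalizing w with
  | _ d ih =>
    by_cases hww : w = w'
    · rw [hww]; exact .refl l _
    suffices ∃ a b : Fin n, w.1 a ≠ w'.1 a ∧ w.1 b ≠ w'.1 b ∧ w.1 a ≠ w.1 b ∧
        IsMultiple q l w (swapWord w a b) ∧ IsSplit l (swapWord w a b).1 by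
      obtain ⟨a, b, ha, hb, hab, h1, h2⟩ := this
      refine h1.trans (ih _ ?_ h2 rfl)
      rw [← hd]
      refine Finset.card_lt_card ((Finset.ssubset_iff_of_subset ?_).2 ⟨a, by simpa using ha, ?_⟩)
      · intro x
        simp only [Finset.mem_filter, Finset.mem_univ, true_and]
        by_cases hxa : x = a
        · subst hxa; exact fun _ => ha
        · by_cases hxb : x = b
          · subst hxb; exact fun _ => hb
          · rw [swapWord_of_ne w hxa hxb]; exact id
      · simp only [Finset.mem_filter, Finset.mem_univ, true_and, swapWord_left]
        omega
    -- Reduce the number of disagreements by one exchange.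
    by_cases hout : ∃ i : Fin n, w.1 i ≠ w'.1 i ∧ n ≤ i.val + 2 * l
    · obtain ⟨i, hi, hil⟩ := hout
      -- The pair that contains `i`.
      let j := (n - 1 - i.val) / 2
      let a : Fin n := ⟨n - 2 - 2 * j, by omega⟩
      let b : Fin n := ⟨n - 2 - 2 * j + 1, by omega⟩
      have hia : i = a ∨ i = b := by
        simp only [Fin.ext_iff, a, b, j]; omega
      have hj : j < l := by omega
      have h1 := hw a b rfl j hj rfl
      have h2 := hw' a b rfl j hj rfl
      refine ⟨a, b, ?_, ?_, h1, isMultiple_swapWord_pair l rfl hj rfl w, ?_⟩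
      · rcases hia with h | h <;> rw [h] at hi <;> omega
      · rcases hia with h | h <;> rw [h] at hi <;> omega
      · intro a' b' hab' j' hj' ha'
        by_cases hjj : j' = j
        · obtain rfl : a' = a := Fin.ext (by rw [ha', hjj])
          obtain rfl : b' = b := Fin.ext hab'.symm
          rw [swapWord_left, swapWord_right]
          exact h1.symm
        · rw [swapWord_of_ne, swapWord_of_ne]
          · exact hw a' b' hab' j' hj' ha'
          all_goals simp only [ne_eq, Fin.ext_iff, a, b]; omega
    · push Not at hout
      obtain ⟨i, hi⟩ : ∃ i, w.1 i ≠ w'.1 i := by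
        by_contra! h
        exact hww (Subtype.ext (funext h))
      obtain ⟨j, hj, hij⟩ : ∃ j, w.1 j ≠ w'.1 j ∧ w.1 i ≠ w.1 j := by
        by_contra! h
        -- Otherwise `w'` would have fewer letters `w i` than `w`.
        refine (Finset.card_lt_card (s := Finset.univ.filter fun x => w'.1 x = w.1 i)
          (t := Finset.univ.filter fun x => w.1 x = w.1 i) ?_).ne
          (card_filter_eq_of_excess (w'.2.trans w.2.symm) _)
        refine (Finset.ssubset_iff_of_subset ?_).2 ⟨i, by simp, by simpa using hi.symm⟩
        intro x
        simp only [Finset.mem_filter, Finset.mem_univ, true_and]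
        intro hx
        by_contra hx'
        exact hx' (h x (by rw [hx]; exact hx')).symm
      have hne : i ≠ j := fun h => hij (by rw [h])
      refine ⟨i, j, hi, hj, hij, ?_, ?_⟩
      · rcases lt_or_gt_of_ne hne with h | h
        · exact isMultiple_swapWord hq l h (hout j hj) w
        · have := isMultiple_swapWord hq l h (hout i hi) w
          rwa [swapWord_comm] at this
      · intro a b hab j' hj' ha
        have h1 := hout i hi
        have h2 := hout j hj
        rw [swapWord_of_ne, swapWord_of_ne]
        · exact hw a b hab j' hj' ha
        all_goals simp only [ne_eq, Fin.ext_iff]; omega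

theorem excess_eq_iff {n r : ℕ} (w : Fin n → Fin 2) :
    excess w = 2 * (r : ℤ) - n ↔ (Finset.univ.filter fun i => w i = 0).card = r ∧
      (Finset.univ.filter fun i => w i = 1).card + r = n := by
  have := Finset.card_filter_add_card_filter_not (s := (Finset.univ : Finset (Fin n)))
    (fun i => w i = 0)
  rw [Finset.card_univ, Fintype.card_fin] at this
  have h1 : (Finset.univ.filter fun i => w i = 1) = Finset.univ.filter fun i => ¬ w i = 0 := by
    ext i
    simp only [Finset.mem_filter, Finset.mem_univ, true_and]
    omega
  rw [excess, h1]
  omega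

theorem card_words (n r : ℕ) :
    Fintype.card {w : Fin n → Fin 2 // excess w = 2 * (r : ℤ) - n} = n.choose r := by
  have : (Finset.powersetCard r (Finset.univ : Finset (Fin n))).card = n.choose r := by simp
  rw [← this, Fintype.card_subtype]
  refine Finset.card_bij (fun w _ => Finset.univ.filter fun i => w i = 0) ?_ ?_ ?_
  · intro w hw
    rw [Finset.mem_filter, excess_eq_iff] at hw
    exact Finset.mem_powersetCard.2 ⟨Finset.subset_univ _, hw.2.1⟩
  · intro w _ w' _ h
    funext i
    have := congrArg (fun S => i ∈ S) h
    simp only [Finset.mem_filter, Finset.mem_univ, true_and, eq_iff_iff] at this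
    omega
  · intro S hS
    have h1 : (Finset.univ.filter fun i => (if i ∈ S then (0 : Fin 2) else 1) = 0) = S := by
      ext i; by_cases h : i ∈ S <;> simp [h]
    refine ⟨fun i => if i ∈ S then 0 else 1, ?_, h1⟩
    have hr := (Finset.mem_powersetCard.1 hS).2
    have h2 : (Finset.univ.filter fun i => (if i ∈ S then (0 : Fin 2) else 1) = 1) = Sᶜ := by
      ext i; by_cases h : i ∈ S <;> simp [h]
    have h3 := Finset.card_add_card_compl S
    rw [Fintype.card_fin] at h3
    rw [Finset.mem_filter, excess_eq_iff, h1, h2]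
    exact ⟨Finset.mem_univ _, hr, by omega⟩

/-- Each `Δ(l)` with `l ≤ min(r, n - r)` occurs exactly once as a layer. -/
theorem permModule_hasFiltration_standard (hq : qTwo q ≠ 0) (n r : ℕ) (hr : r ≤ n) :
    HasFiltration (TL q n) (fun l => Standard (TL.idem q n) l)
      (permModule q (2 * (r : ℤ) - n) n) := by
  have : Module.Finite k (permModule q (2 * (r : ℤ) - n) n) :=
    Module.Finite.of_basis (permBasis q _ n)
  have hnot : ∀ l : Fin (n / 2 + 1), min r (n - r) < l →
      ∀ w : {w : Fin n → Fin 2 // excess w = 2 * (r : ℤ) - n}, ¬ IsSplit l w.1 := by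
    intro l hl w hw
    have h1 := hw.le_card (by omega) 0
    have h2 := hw.le_card (by omega) 1
    have h3 := (excess_eq_iff w.1).1 w.2
    omega
  have hzero : ∀ l : Fin (n / 2 + 1),
      (∀ w : {w : Fin n → Fin 2 // excess w = 2 * (r : ℤ) - n}, ¬ IsSplit l w.1) →
      ∀ x : permModule q (2 * (r : ℤ) - n) n, TL.idem q n l • x = 0 := by
    intro l hl x
    have : Algebra.lsmul k k (permModule q (2 * (r : ℤ) - n) n) (TL.idem q n l) = 0 :=
      (permBasis q _ n).ext fun w => idem_smul_eq_zero_of_not_isSplit hq l (hl w)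
    exact LinearMap.congr_fun this x
  refine TL.hasFiltration_standard_of_finrank hq (r := min r (n - r)) (by omega) ?_ ?_ ?_
  · rw [Module.finrank_eq_card_basis (permBasis q _ n), card_words]
    rcases le_total r (n - r) with h | h
    · rw [min_eq_left h]
    · rw [min_eq_right h, Nat.choose_symm hr]
  · intro l _
    by_cases hex : ∃ w : {w : Fin n → Fin 2 // excess w = 2 * (r : ℤ) - n}, IsSplit l w.1
    · obtain ⟨w, hw⟩ := hex
      refine ⟨TL.idem q n l • permBasis q _ n w, fun x => ?_⟩
      have hx := (permBasis q (2 * (r : ℤ) - n) n).mem_span x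
      induction hx using Submodule.span_induction with
      | mem x h =>
        obtain ⟨w', rfl⟩ := h
        by_cases hw' : IsSplit l w'.1
        · exact hw.isMultiple hq l hw'
        · refine ⟨0, ?_⟩
          rw [idem_smul_eq_zero_of_not_isSplit hq l hw', zero_smul, sub_zero]
          exact zero_mem _
      | zero => exact ⟨0, by simp⟩
      | add x y _ _ hx hy =>
        obtain ⟨c, hc⟩ := hx
        obtain ⟨d, hd⟩ := hy
        refine ⟨c + d, ?_⟩
        rw [smul_add, add_smul, add_sub_add_comm]
        exact add_mem hc hd
      | smul a x _ hx =>
        obtain ⟨c, hc⟩ := hx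
        refine ⟨a * c, ?_⟩
        rw [smul_comm, mul_smul, ← smul_sub]
        exact Submodule.smul_of_tower_mem _ a hc
    · push Not at hex
      refine ⟨0, fun x => ⟨0, ?_⟩⟩
      rw [hzero l hex, smul_zero, sub_zero]
      exact zero_mem _
  · exact fun l hl x => hzero l (hnot l hl) x

theorem wordBasis_repr_U_symm (i : Fin (n - 1)) (v w : Fin n → Fin 2) :
    (TensorSpace.wordBasis q n).repr (TL.U q i • TensorSpace.wordBasis q n v) w =
      (TensorSpace.wordBasis q n).repr (TL.U q i • TensorSpace.wordBasis q n w) v := by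
  have hi : i.val + 1 < n := by omega
  let a : Fin n := ⟨i, by omega⟩
  let b : Fin n := ⟨i + 1, hi⟩
  have h := fun w => gen_smul_wordBasis q (a := a) (b := b) rfl w
  rw [TL.gen_of_lt q (show a.val < n - 1 from i.2)] at h
  change (TensorSpace.wordBasis q n).repr (TL.U q ⟨a, i.2⟩ • TensorSpace.wordBasis q n v) w =
      (TensorSpace.wordBasis q n).repr (TL.U q ⟨a, i.2⟩ • TensorSpace.wordBasis q n w) v
  rw [h, h]
  have hsw : ∀ w : Fin n → Fin 2, (w ∘ Equiv.swap a b) ∘ Equiv.swap a b = w := fun w => by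
    ext x; simp
  by_cases hvw : v = w
  · rw [hvw]
  have hvw' : ¬ w = v := fun h => hvw h.symm
  by_cases hsvw : v ∘ Equiv.swap a b = w
  · have hsvw' : w ∘ Equiv.swap a b = v := by rw [← hsvw, hsw]
    have e1 : w a = v b := by rw [← hsvw]; simp
    have e2 : w b = v a := by rw [← hsvw]; simp
    by_cases hv : v a = v b
    · rw [if_pos hv, if_pos (by rw [e1, e2, hv])]
      simp
    · have hw : ¬ w a = w b := by rw [e1, e2]; exact fun h => hv h.symm
      rw [if_neg hv, if_neg hw]
      split_ifs <;> simp [hvw, hvw', hsvw, hsvw']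
  · have hsvw' : ¬ w ∘ Equiv.swap a b = v := fun h => hsvw (by rw [← h, hsw])
    split_ifs <;> simp [hvw, hvw', hsvw, hsvw']

theorem permModule_isTilting (hq : qTwo q ≠ 0) (n r : ℕ) (hr : r ≤ n) :
    IsTilting k (TL.idem q n) (permModule q (2 * (r : ℤ) - n) n) := by
  have h := permModule_hasFiltration_standard hq n r hr
  have : Module.Finite k (permModule q (2 * (r : ℤ) - n) n) :=
    Module.Finite.of_basis (permBasis q _ n)
  refine ⟨Module.Finite.of_restrictScalars_finite k _ _, h,
    TL.hasFiltration_costandard_of_symmetric (permBasis q _ n) (fun i v w => ?_) h⟩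
  rw [permBasis_repr, permBasis_repr, Submodule.coe_smul, Submodule.coe_smul, coe_permBasis,
    coe_permBasis]
  exact wordBasis_repr_U_symm i v.1 w.1

/-! ### The tensor space -/

variable (q n) in
/-- The sum of the permutation modules `M(2r - n, n)` with `r < t`. -/
noncomputable def permSum : ℕ → Submodule (TL q n) (TensorSpace q n)
  | 0 => ⊥
  | t + 1 => permSum t ⊔ permModule q (2 * (t : ℤ) - n) n

theorem repr_eq_zero_of_mem_permSum {t : ℕ} {x : TensorSpace q n} (hx : x ∈ permSum q n t)
    {w : Fin n → Fin 2} (hw : 2 * (t : ℤ) - n ≤ excess w) :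
    (TensorSpace.wordBasis q n).repr x w = 0 := by
  induction t generalizing x with
  | zero => rw [(Submodule.mem_bot _).1 hx]; simp
  | succ t ih =>
    obtain ⟨y, hy, z, hz, rfl⟩ := Submodule.mem_sup.1 hx
    push_cast at hw
    rw [map_add, Finsupp.add_apply, ih hy (by omega), zero_add]
    by_contra h
    have := (mem_permModule_iff q).1 hz w h
    omega

theorem permModule_le_permSum {r t : ℕ} (h : r < t) :
    permModule q (2 * (r : ℤ) - n) n ≤ permSum q n t := by
  induction t with
  | zero => omega
  | succ t ih =>
    rcases Nat.lt_succ_iff_lt_or_eq.1 h with h | rfl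
    · exact (ih h).trans le_sup_left
    · exact le_sup_right

theorem permSum_eq_top : permSum q n (n + 1) = ⊤ := by
  rw [eq_top_iff]
  intro x _
  have hx := (TensorSpace.wordBasis q n).mem_span x
  induction hx using Submodule.span_induction with
  | mem x h =>
    obtain ⟨w, rfl⟩ := h
    have hle : (Finset.univ.filter fun i => w i = 0).card ≤ n := by
      simpa using Finset.card_filter_le (Finset.univ : Finset (Fin n)) (fun i => w i = 0)
    refine permModule_le_permSum (r := (Finset.univ.filter fun i => w i = 0).card) (by omega) ?_
    have := (excess_eq_iff (r := (Finset.univ.filter fun i => w i = 0).card) w).2 ⟨rfl, ?_⟩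
    · rw [← this]
      exact wordBasis_mem_permModule q w
    · have h1 := Finset.card_filter_add_card_filter_not (s := (Finset.univ : Finset (Fin n)))
        (fun i => w i = 1)
      rw [Finset.card_univ, Fintype.card_fin] at h1
      refine Eq.trans ?_ h1
      congr 2
      ext i
      simp only [Finset.mem_filter, Finset.mem_univ, true_and]
      omega
  | zero => exact zero_mem _
  | add x y _ _ hx hy => exact add_mem (hx trivial) (hy trivial)
  | smul c x _ hx => exact Submodule.smul_of_tower_mem _ c (hx trivial)

theorem tensorSpace_hasFiltration_standard (hq : qTwo q ≠ 0) (n : ℕ) :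
    HasFiltration (TL q n) (fun l => Standard (TL.idem q n) l) (TensorSpace q n) := by
  rw [hasFiltration_iff_isFiltered_top, ← permSum_eq_top]
  suffices ∀ t ≤ n + 1, IsFiltered (fun l => Standard (TL.idem q n) l) (permSum q n t) from
    this _ le_rfl
  intro t
  induction t with
  | zero => exact fun _ => .bot
  | succ t ih =>
    intro ht
    have h := (ih (by omega)).sup_map (permModule q (2 * (t : ℤ) - n) n).subtype ?_
      ((hasFiltration_iff_isFiltered_top _).1 (permModule_hasFiltration_standard hq n t (by omega)))
    · rwa [Submodule.map_top, Submodule.range_subtype] at h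
    · rintro ⟨x, hx⟩ hxt
      apply Subtype.ext
      refine (TensorSpace.wordBasis q n).repr.injective (Finsupp.ext fun w => ?_)
      by_contra h
      simp only [ZeroMemClass.coe_zero, map_zero, Finsupp.coe_zero, Pi.zero_apply] at h
      exact h (repr_eq_zero_of_mem_permSum hxt ((mem_permModule_iff q).1 hx w h).ge)

theorem tensorSpace_isTilting (hq : qTwo q ≠ 0) (n : ℕ) :
    IsTilting k (TL.idem q n) (TensorSpace q n) := by
  have h := tensorSpace_hasFiltration_standard hq n
  have : Module.Finite k (TensorSpace q n) := Module.Finite.of_basis (TensorSpace.wordBasis q n)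
  exact ⟨Module.Finite.of_restrictScalars_finite k _ _, h,
    TL.hasFiltration_costandard_of_symmetric (TensorSpace.wordBasis q n) wordBasis_repr_U_symm h⟩

end PermModule

/-! ### The adjunction map -/

namespace TL

universe u w

variable {k : Type u} [Field k] {q : k} {n : ℕ} {M : Type w} [AddCommGroup M] [Module k M]
  [Module (TL q (n + 2)) M] [IsScalarTower k (TL q (n + 2)) M]

theorem idemNat_one (q : k) (n : ℕ) : idemNat q (n + 2) 1 = eps q n := by
  rw [idemNat, idemNat, one_mul, eps, gen_of_lt q (by omega)]
  rfl

theorem eps_mul_eps (hq : qTwo q ≠ 0) : eps q n * eps q n = eps q n := by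
  rw [← idemNat_one, idemNat_mul_idemNat hq (by omega) le_rfl]

theorem eps_mul_idem (hq : qTwo q ≠ 0) {l : Fin ((n + 2) / 2 + 1)} (hl : 1 ≤ l.val) :
    eps q n * idem q (n + 2) l = idem q (n + 2) l := by
  rw [← idemNat_one, idem_eq, idemNat_mul_idemNat hq (by omega) hl]

theorem idem_mul_eps (hq : qTwo q ≠ 0) {l : Fin ((n + 2) / 2 + 1)} (hl : 1 ≤ l.val) :
    idem q (n + 2) l * eps q n = idem q (n + 2) l := by
  rw [← idemNat_one, idem_eq, idemNat_mul_idemNat' hq (by omega) hl]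

theorem mul_eps_of_mem (hq : qTwo q ≠ 0) (x : ↥(Ideal.span {eps q n})) : x.1 * eps q n = x.1 := by
  obtain ⟨a, ha⟩ := Ideal.mem_span_singleton'.1 x.2
  rw [← ha, mul_assoc, eps_mul_eps hq]

theorem eps_smul_val (hq : qTwo q ≠ 0) (m : Loc q n M) :
    eps q n • Loc.val q n M m = Loc.val q n M m := by
  obtain ⟨_, y, rfl⟩ := m
  change eps q n • eps q n • y = eps q n • y
  rw [← mul_smul, eps_mul_eps hq]

theorem val_injective : Function.Injective (Loc.val q n M) := Subtype.val_injective

theorem exists_val_eq {x : M} (hx : eps q n • x = x) : ∃ m, Loc.val q n M m = x :=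
  ⟨⟨x, x, hx⟩, rfl⟩

/-- The element `x ⊗ m` of `G (F M)`. -/
def globTmul (x : ↥(Ideal.span {eps q n})) (m : Loc q n M) : Glob q n (Loc q n M) :=
  Submodule.Quotient.mk (x ⊗ₜ[k] m)

theorem globTmul_add_left (x y : ↥(Ideal.span {eps q n})) (m : Loc q n M) :
    globTmul (x + y) m = globTmul x m + globTmul y m := by
  rw [globTmul, TensorProduct.add_tmul]; rfl

theorem globTmul_smul_left (a : TL q (n + 2)) (x : ↥(Ideal.span {eps q n})) (m : Loc q n M) :
    globTmul (a • x) m = a • globTmul x m := rfl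

theorem globTmul_zero_left (m : Loc q n M) : globTmul (0 : ↥(Ideal.span {eps q n})) m = 0 := by
  rw [globTmul, TensorProduct.zero_tmul]; rfl

theorem globTmul_add_right (x : ↥(Ideal.span {eps q n})) (m m' : Loc q n M) :
    globTmul x (m + m') = globTmul x m + globTmul x m' := by
  rw [globTmul, TensorProduct.tmul_add]; rfl

theorem globTmul_zero_right (x : ↥(Ideal.span {eps q n})) :
    globTmul x (0 : Loc q n M) = 0 := by
  rw [globTmul, TensorProduct.tmul_zero]; rfl

theorem globTmul_rightMul (x : ↥(Ideal.span {eps q n})) (a : TL q n) (m : Loc q n M) :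
    globTmul (rightMul q n x a) m = globTmul x (a • m) :=
  (Submodule.Quotient.eq _).2 (Submodule.subset_span ⟨x, a, m, rfl⟩)

theorem adjunctionMap_globTmul (x : ↥(Ideal.span {eps q n})) (m : Loc q n M) :
    adjunctionMap q n M (globTmul x m) = x.1 • Loc.val q n M m := rfl

/-- The image of `G (F N)` in `G (F M)` for a submodule `N` of `M`. -/
def globSubmodule (N : Submodule (TL q (n + 2)) M) :
    Submodule (TL q (n + 2)) (Glob q n (Loc q n M)) :=
  Submodule.span _ {g | ∃ x m, Loc.val q n M m ∈ N ∧ g = globTmul x m}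

theorem globTmul_mem {N : Submodule (TL q (n + 2)) M} (x : ↥(Ideal.span {eps q n}))
    {m : Loc q n M} (hm : Loc.val q n M m ∈ N) : globTmul x m ∈ globSubmodule N :=
  Submodule.subset_span ⟨x, m, hm, rfl⟩

theorem adjunctionMap_mem {N : Submodule (TL q (n + 2)) M} {g : Glob q n (Loc q n M)}
    (hg : g ∈ globSubmodule N) : adjunctionMap q n M g ∈ N := by
  suffices globSubmodule N ≤ N.comap (adjunctionMap q n M) from this hg
  refine Submodule.span_le.2 ?_
  rintro _ ⟨x, m, hm, rfl⟩
  exact N.smul_mem x.1 hm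

theorem globSubmodule_top : globSubmodule (⊤ : Submodule (TL q (n + 2)) M) = ⊤ := by
  rw [eq_top_iff]
  intro g _
  obtain ⟨t, rfl⟩ := Submodule.mkQ_surjective _ g
  induction t using TensorProduct.induction_on with
  | zero => rw [map_zero]; exact zero_mem _
  | tmul x m => exact globTmul_mem x trivial
  | add s t hs ht => rw [map_add]; exact add_mem (hs trivial) (ht trivial)

/-- Injectivity of the adjunction map on `G (F N)` passes from `N` to `N'` if `N' / N` is a standard
module. -/
theorem adjunctionMap_eq_zero_of_layer (hq : qTwo q ≠ 0) {N N' : Submodule (TL q (n + 2)) M}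
    {l : Fin ((n + 2) / 2 + 1)} (h : IsLayer (fun l => Standard (idem q (n + 2)) l) N N' l)
    (hN : ∀ g ∈ globSubmodule N, adjunctionMap q n M g = 0 → g = 0) :
    ∀ g ∈ globSubmodule N', adjunctionMap q n M g = 0 → g = 0 := by
  obtain ⟨hle, f, hf, hker⟩ := h
  rcases Nat.eq_zero_or_pos l.val with hl | hl
  · -- `ε` annihilates `Δ(0)`, so that `ε N' ≤ N`.
    suffices globSubmodule N' ≤ globSubmodule N from fun g hg => hN g (this hg)
    refine Submodule.span_le.2 ?_
    rintro _ ⟨x, m, hm, rfl⟩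
    refine globTmul_mem x ((hker ⟨_, hm⟩).1 ?_)
    have h1 : (⟨Loc.val q n M m, hm⟩ : N') = eps q n • ⟨Loc.val q n M m, hm⟩ :=
      Subtype.ext (eps_smul_val hq m).symm
    rw [h1, map_smul]
    obtain ⟨t, ht⟩ := Submodule.mkQ_surjective _ (f ⟨Loc.val q n M m, hm⟩)
    rw [← ht]
    refine (Submodule.Quotient.mk_eq_zero _).2 ?_
    refine higherIdeal_mul_mem ?_ t.1
    rw [← idemNat_one]
    exact idemNat_mem_higherIdeal l (by omega) (by omega)
  · set e := idem q (n + 2) l with he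
    have hee : e * e = e := by rw [he, idem_eq, idemNat_mul_idemNat hq (by omega) le_rfl]
    have hemem : e ∈ Ideal.span {idem q (n + 2) l} := Ideal.mem_span_singleton_self _
    obtain ⟨z₀, hz₀⟩ := hf (Submodule.Quotient.mk ⟨e, hemem⟩)
    let z : N' := e • z₀
    have hez : e • z.1 = z.1 := by
      change e • e • z₀.1 = e • z₀.1
      rw [← mul_smul, hee]
    have hfz : ∀ a : TL q (n + 2), f (a • z) =
        Submodule.Quotient.mk ⟨a * e, Ideal.mul_mem_left _ a hemem⟩ := by
      intro a
      rw [map_smul, map_smul, hz₀]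
      refine congrArg Submodule.Quotient.mk (Subtype.ext ?_)
      change a * (e * e) = a * e
      rw [hee]
    have hmemN : ∀ a : TL q (n + 2), a • z.1 ∈ N ↔ a * e ∈ higherIdeal (idem q (n + 2)) l := by
      intro a
      rw [← Submodule.coe_smul, ← hker, hfz, Submodule.Quotient.mk_eq_zero]
      rfl
    have hepsz : eps q n • z.1 = z.1 := by
      rw [← hez, ← mul_smul, eps_mul_idem hq hl]
    obtain ⟨zL, hzL⟩ := exists_val_eq hepsz
    have hsmul : ∀ b : TL q n, Loc.val q n M (b • zL) = (eps q n * incl q n b) • z.1 := by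
      intro b
      rw [Loc.val_smul, hzL, eps_comm, mul_smul, hepsz]
    -- `ε N'` is generated by `z` modulo `ε N`.
    have hgen : ∀ m, Loc.val q n M m ∈ N' → ∃ (b : TL q n) (m₀ : Loc q n M),
        Loc.val q n M m₀ ∈ N ∧ m = b • zL + m₀ := by
      intro m hm
      obtain ⟨⟨t, ht⟩, h1⟩ := Submodule.mkQ_surjective _ (f ⟨_, hm⟩)
      obtain ⟨a, rfl⟩ := Ideal.mem_span_singleton'.1 ht
      obtain ⟨b, hb⟩ := exists_eps_mul_mul_eps q n a
      refine ⟨b, m - b • zL, ?_, by abel⟩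
      have h2 : Loc.val q n M m - a • z.1 ∈ N := by
        refine (hker (⟨_, hm⟩ - a • z)).1 ?_
        rw [map_sub, ← h1, hfz]
        exact sub_self _
      have h3 := N.smul_mem (eps q n) h2
      rw [smul_sub, eps_smul_val hq] at h3
      rw [map_sub, hsmul, ← hb, mul_smul, hepsz, mul_smul]
      exact h3
    have hrep : ∀ g ∈ globSubmodule N', ∃ t, g - globTmul t zL ∈ globSubmodule N := by
      intro g hg
      induction hg using Submodule.span_induction with
      | mem g hg =>
        obtain ⟨x, m, hm, rfl⟩ := hg
        obtain ⟨b, m₀, hm₀, rfl⟩ := hgen m hm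
        refine ⟨rightMul q n x b, ?_⟩
        rw [globTmul_rightMul, globTmul_add_right, add_sub_cancel_left]
        exact globTmul_mem x hm₀
      | zero => exact ⟨0, by rw [globTmul_zero_left, sub_zero]; exact zero_mem _⟩
      | add g g' _ _ h h' =>
        obtain ⟨t, ht⟩ := h
        obtain ⟨t', ht'⟩ := h'
        refine ⟨t + t', ?_⟩
        rw [globTmul_add_left, add_sub_add_comm]
        exact add_mem ht ht'
      | smul a g _ h =>
        obtain ⟨t, ht⟩ := h
        refine ⟨a • t, ?_⟩
        rw [globTmul_smul_left, ← smul_sub]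
        exact Submodule.smul_mem _ a ht
    -- `e` belongs to `ε T_n`.
    obtain ⟨b, hb⟩ := exists_eps_mul_mul_eps q n e
    rw [eps_mul_idem hq hl, idem_mul_eps hq hl, ← he] at hb
    have hbz : b • zL = zL := val_injective (by rw [hsmul, ← hb, hez, hzL])
    let ρ : TL q (n + 2) → ↥(Ideal.span {eps q n}) := fun s =>
      ⟨s * e, by
        rw [hb, eps_comm, ← mul_assoc]
        exact Ideal.mul_mem_left _ _ (Ideal.mem_span_singleton_self _)⟩
    have hρ : ∀ s ∈ higherIdeal (idem q (n + 2)) l, globTmul (ρ s) zL ∈ globSubmodule N := by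
      intro s hs
      induction hs using Submodule.span_induction with
      | mem s hs =>
        obtain ⟨j, hj, c, rfl⟩ := hs
        have hj' : 1 ≤ j.val := hl.trans_le (Fin.lt_def.1 hj).le
        obtain ⟨d, hd⟩ := exists_eps_mul_mul_eps q n (idem q (n + 2) j * c * e)
        rw [mul_assoc, mul_assoc (_ * c), idem_mul_eps hq hl, mul_assoc, ← mul_assoc,
          eps_mul_idem hq hj', ← mul_assoc] at hd
        have : ρ (idem q (n + 2) j * c) =
            rightMul q n ⟨eps q n, Ideal.mem_span_singleton_self _⟩ d := Subtype.ext hd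
        rw [this, globTmul_rightMul]
        refine globTmul_mem _ ?_
        rw [hsmul, ← hd, hmemN, mul_assoc, mul_assoc]
        exact Ideal.subset_span ⟨j, hj, _, rfl⟩
      | zero =>
        have : ρ 0 = 0 := Subtype.ext (zero_mul e)
        rw [this, globTmul_zero_left]
        exact zero_mem _
      | add s s' _ _ h h' =>
        have : ρ (s + s') = ρ s + ρ s' := Subtype.ext (add_mul s s' e)
        rw [this, globTmul_add_left]
        exact add_mem h h'
      | smul a s _ h =>
        have : ρ (a • s) = a • ρ s := Subtype.ext (mul_assoc a s e)
        rw [this, globTmul_smul_left]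
        exact Submodule.smul_mem _ a h
    intro g hg hg0
    obtain ⟨t, ht⟩ := hrep g hg
    have htz : t.1 • z.1 ∈ N := by
      have := adjunctionMap_mem ht
      rw [map_sub, hg0, zero_sub, adjunctionMap_globTmul, hzL] at this
      exact neg_mem_iff.1 this
    have hte : t.1 * e ∈ higherIdeal (idem q (n + 2)) l := (hmemN t.1).1 htz
    have hρt : globTmul t zL = globTmul (ρ (t.1 * e)) zL := by
      have : ρ (t.1 * e) = rightMul q n t b := Subtype.ext (by
        change t.1 * e * e = t.1 * incl q n b
        rw [mul_assoc, hee, hb, ← mul_assoc, mul_eps_of_mem hq])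
      rw [this, globTmul_rightMul, hbz]
    refine hN g ?_ hg0
    rw [← sub_add_cancel g (globTmul t zL)]
    refine add_mem ht ?_
    rw [hρt]
    exact hρ _ hte

theorem adjunctionMap_injective (hq : qTwo q ≠ 0)
    (h : HasFiltration (TL q (n + 2)) (fun l => Standard (idem q (n + 2)) l) M) :
    Function.Injective (adjunctionMap q n M) := by
  rw [hasFiltration_iff_isFiltered_top] at h
  have key : ∀ N : Submodule (TL q (n + 2)) M,
      IsFiltered (fun l => Standard (idem q (n + 2)) l) N →
      ∀ g ∈ globSubmodule N, adjunctionMap q n M g = 0 → g = 0 := by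
    intro N hN
    induction hN with
    | bot =>
      intro g hg _
      suffices globSubmodule (⊥ : Submodule (TL q (n + 2)) M) ≤ ⊥ from this hg
      refine Submodule.span_le.2 ?_
      rintro _ ⟨x, m, hm, rfl⟩
      have hm : m = 0 := val_injective ((Submodule.mem_bot _).1 hm)
      rw [hm, globTmul_zero_right]
      exact zero_mem _
    | step l _ h ih => exact adjunctionMap_eq_zero_of_layer hq h ih
  rw [injective_iff_map_eq_zero]
  intro g hg
  exact key ⊤ h g (by rw [globSubmodule_top]; trivial) hg

end TL

theorem mainTheorem4 {k : Type*} [Field k] (q : k) [NeZero q] (hq : qTwo q ≠ 0) :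
    (∀ n : ℕ, IsTilting k (TL.idem q n) (TensorSpace q n)) ∧
    (∀ n r : ℕ, r ≤ n →
      IsTilting k (TL.idem q n) (permModule q (2 * (r : ℤ) - (n : ℤ)) n)) ∧
    (∀ n : ℕ, Function.Injective (TL.adjunctionMap q n (TensorSpace q (n + 2)))) :=
  ⟨tensorSpace_isTilting hq, permModule_isTilting hq, fun n =>
    TL.adjunctionMap_injective hq (tensorSpace_hasFiltration_standard hq (n + 2))⟩
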